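/- Let $n\ge 2$, $m\ge 1$, $U=[0,1]^n$. Hyperplanes $l$ are oriented, given by an equation $w^Tx+b=0$ with $w\ne0$ (up to a positive factor); $l^+=\{w^Tx+b\ge 0\}$, $l^0=\{w^Tx+b\le 0\}$, and $l\prec l'$ means $l'^+\cap U\subsetneq l^+\cap U$. Let $H$ be a set of oriented hyperplanes forming a standard partition of $U$: $H$ consists of $n$ chains $l_{i1}\prec l_{i2}\prec\dots\prec l_{ik_i}$ ($1\le i\le n$, $k_i\ge0$) such that, for every choice of one layer from each chain (a layer of chain $i$ being a set of points strictly between two consecutive hyperplanes of the chain, or before the first, or after the last), the chosen layers have a common point in the interior of $U$; an example is a grid of coordinate hyperplanes. Let $\mathcal R$ be the set of the regions into which $H$ divides $U$ (closures of the connected components of the interior of $U$ minus the hyperplanes), and $\zeta=|\mathcal R|$. Let $\mathfrak S_n^m(H,\mathcal R)$ be the space of functions $s$ on $U$ that agree on each $R\in\mathcal R$ with a polynomial $p_R$ of degree at most $m$, such that for adjacent regions $R,R'$ (with $\dim(R\cap R')=n-1$), at each point of $R\cap R'$ and along each line crossing the separating hyperplane there, the derivatives of $p_R$ and $p_{R'}$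 of orders $0,\dots,m-1$ agree. Let $\sigma\in C^m(\mathbb R)$ be a generalized sigmoidal function: $\sigma$ is increasing on $(-\infty,0]$ and $\lim_{x\to-\infty}\sigma(x)=0$. Assume that $\sigma$ does not agree on $(0,\infty)$ with a polynomial whose degree is different from $m$. For a two-layer network $N(x)=\sum_{i=1}^{\Theta}\lambda_i\sigma(w_i^Tx+b_i)$ with $w_i\neq0$, $\lambda_i\ne0$, a target $f$ and $\varepsilon>0$ with $\|f-N\|_{L^2(U)}<\varepsilon$, the zero-error hyperplane of unit $i$ is $w_i^Tx+c^*=0$, where $c^*$ is the infimum of the $c\ge b_i$ such that the $L^2(U)$ error is still less than $\varepsilon$ after $\sigma(w_i^Tx+b_i)$ has been replaced by $0$ on $\{w_i^Tx+c\le0\}$. We say that $N$ realizes $f$ from $H$ with precision $\varepsilon$ if $\|f-N\|_{L^2(U)}<\varepsilon$; to each $l\in H$ there corresponds exactly one local unit of $N$ (different ones to different $l$), and its zero-error hyperplane is $l$, with the same orientation; and all other units are global units from universal global hyperplanes, i.e. $U\subset\{w_i^Tx+b_i\ge0\}$, of which at least $\binom{n+m}{m}$ are distinct. Then for every spline $\mathcal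 S\in\mathfrak S_n^m(H,\mathcal R)$: (a) for every $\varepsilon>0$ there is a two-layer network with activation function $\sigma$ that realizes $\mathcal S$ from $H$ with precision $\varepsilon$; (b) $\zeta$ is finite, and for every $\varepsilon>0$ the number $\Theta$ of hidden units of every network that realizes $\mathcal S$ from $H$ with precision $\varepsilon$ satisfies $$\Theta\ \ge\ (\zeta^{1/n}-1)\,n+\binom{n+m}{m}.$$ -/

import Mathlib

open MeasureTheory Filter Topology

noncomputable section

/-- The cube `U = [0,1]^n`, in Euclidean `n`-space. -/
def unitCube (n : ℕ) : Set (EuclideanSpace ℝ (Fin n)) :=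
  {x | ∀ i, x i ∈ Set.Icc (0 : ℝ) 1}

/-- An oriented hyperplane `w · x + b = 0` with `w ≠ 0` (a knot). -/
structure OrientedHyperplane (n : ℕ) where
  normal : EuclideanSpace ℝ (Fin n)
  bias : ℝ
  normal_ne : normal ≠ 0

namespace OrientedHyperplane

variable {n : ℕ}

/-- The affine function `x ↦ w · x + b`. -/
def eval (h : OrientedHyperplane n) (x : EuclideanSpace ℝ (Fin n)) : ℝ :=
  inner ℝ h.normal x + h.bias

/-- The hyperplane itself, as a set of points. -/
def carrier (h : OrientedHyperplane n) : Set (EuclideanSpace ℝ (Fin n)) :=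
  {x | h.eval x = 0}

/-- The half-space `l⁺`, boundary included. -/
def pos (h : OrientedHyperplane n) : Set (EuclideanSpace ℝ (Fin n)) :=
  {x | 0 ≤ h.eval x}

/-- The half-space `l⁰`, boundary included. -/
def neg (h : OrientedHyperplane n) : Set (EuclideanSpace ℝ (Fin n)) :=
  {x | h.eval x ≤ 0}

/-- The strict partial order `l ≺ l'` over the cube: within the cube, the positive side of `l'`
is strictly contained in that of `l`, as `x < x'` says that `(x', 1]` is strictly contained in
`(x, 1]`. In particular the two hyperplanes do not cross in the interior of the cube. -/
def Precedes (l l' : OrientedHyperplane n) : Prop :=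
  unitCube n ∩ l'.pos ⊂ unitCube n ∩ l.pos

/-- A universal global hyperplane of the cube: the whole cube lies on its positive side. -/
def IsUniversalGlobal (h : OrientedHyperplane n) : Prop :=
  unitCube n ⊆ h.pos

end OrientedHyperplane

/-- The regions into which the hyperplanes of `H` divide the cube, boundaries included. -/
def regions {n : ℕ} (H : Set (OrientedHyperplane n)) : Set (Set (EuclideanSpace ℝ (Fin n))) :=
  {R | ∃ x ∈ interior (unitCube n) \ ⋃ h ∈ H, h.carrier,
    R = closure (connectedComponentIn (interior (unitCube n) \ ⋃ h ∈ H, h.carrier) x)}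

/-- `H` forms a standard partition of the cube: `H` consists of `n` chains
`l i 0 ≺ l i 1 ≺ ⋯` of `k i` hyperplanes each, and, as for a grid of coordinate hyperplanes, every
choice `c` of one layer of each chain (layer `c i` of chain `i` lies between the
hyperplanes `l i (c i - 1)` and `l i (c i)`) gives a nonempty open cell of the cube. -/
def IsStandardPartition {n : ℕ} (H : Set (OrientedHyperplane n)) : Prop :=
  ∃ (k : Fin n → ℕ) (l : (i : Fin n) → Fin (k i) → OrientedHyperplane n),
    H = {h | ∃ i j, h = l i j} ∧
    (∀ i j j', j < j' → (l i j).Precedes (l i j')) ∧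
    ∀ c : (i : Fin n) → Fin (k i + 1),
      ∃ x ∈ interior (unitCube n), ∀ (i : Fin n) (j : Fin (k i)),
        ((j : ℕ) < (c i : ℕ) → 0 < (l i j).eval x) ∧
        ((c i : ℕ) ≤ (j : ℕ) → (l i j).eval x < 0)

/-- Two regions are adjacent if they are distinct and their intersection has dimension `n - 1`. -/
def AdjacentRegions {n : ℕ} (R R' : Set (EuclideanSpace ℝ (Fin n))) : Prop :=
  R ≠ R' ∧ Module.finrank ℝ (vectorSpan ℝ (R ∩ R')) = n - 1

/-- The value of an `n`-variate polynomial at a point of Euclidean space. -/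
def polyEval {n : ℕ} (p : MvPolynomial (Fin n) ℝ) (x : EuclideanSpace ℝ (Fin n)) : ℝ :=
  MvPolynomial.eval (fun i => x i) p

/-- `p` and `q` are smoothly continuous with order `m - 1` at the part `A` of the hyperplane `h`:
along every line that crosses `h` at a point of `A`, the derivatives of order `0, …, m - 1` of `p`
and `q` agree at that point. -/
def SmoothlyContinuousAt {n : ℕ} (m : ℕ) (h : OrientedHyperplane n)
    (A : Set (EuclideanSpace ℝ (Fin n))) (p q : MvPolynomial (Fin n) ℝ) : Prop :=
  ∀ x ∈ A, ∀ d : EuclideanSpace ℝ (Fin n), inner ℝ h.normal d ≠ 0 → ∀ k < m,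
    iteratedDeriv k (fun t : ℝ => polyEval p (x + t • d)) 0 =
      iteratedDeriv k (fun t : ℝ => polyEval q (x + t • d)) 0

/-- The space of smooth splines of order `m` on the cube, with respect to `H` and its regions
(only the values on the cube matter). -/
def splineSpace {n : ℕ} (H : Set (OrientedHyperplane n)) (m : ℕ) :
    Set (EuclideanSpace ℝ (Fin n) → ℝ) :=
  {s | ∃ p : Set (EuclideanSpace ℝ (Fin n)) → MvPolynomial (Fin n) ℝ,
    (∀ R ∈ regions H, (p R).totalDegree ≤ m ∧ ∀ x ∈ R, s x = polyEval (p R) x) ∧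
    ∀ R ∈ regions H, ∀ R' ∈ regions H, AdjacentRegions R R' →
      ∀ h ∈ H, R ∩ R' ⊆ h.carrier → SmoothlyContinuousAt m h (R ∩ R') (p R) (p R')}

/-- A generalized sigmoidal function. -/
structure IsGeneralizedSigmoidal (σ : ℝ → ℝ) : Prop where
  contDiff : ContDiff ℝ 1 σ
  monotoneOn : MonotoneOn σ (Set.Iic 0)
  tendsto_atBot : Tendsto σ atBot (𝓝 0)

/-- A two-layer network with `n` inputs and `Θ` hidden units: unit `i` has the hyperplane
`plane i` (its input weights and its bias) and the output weight `out i`. -/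
structure TwoLayerNetwork (n Θ : ℕ) where
  plane : Fin Θ → OrientedHyperplane n
  out : Fin Θ → ℝ
  out_ne : ∀ i, out i ≠ 0

namespace TwoLayerNetwork

variable {n Θ : ℕ}

/-- The output `∑ λ_i σ(w_i · x + b_i)` of the network. -/
def output (σ : ℝ → ℝ) (N : TwoLayerNetwork n Θ) (x : EuclideanSpace ℝ (Fin n)) : ℝ :=
  ∑ i, N.out i * σ ((N.plane i).eval x)

open Classical in
/-- The output of the network after the activation function of unit `i` has been truncated at
the hyperplane `w_i · x + c = 0`, that is, replaced by zero where `w_i · x + c ≤ 0`. -/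
def truncatedOutput (σ : ℝ → ℝ) (N : TwoLayerNetwork n Θ) (i : Fin Θ) (c : ℝ)
    (x : EuclideanSpace ℝ (Fin n)) : ℝ :=
  ∑ j, N.out j *
    (if j = i ∧ inner ℝ (N.plane i).normal x + c ≤ 0 then 0 else σ ((N.plane j).eval x))

end TwoLayerNetwork

/-- `‖f - g‖₂ < ε` on the cube. -/
def ApproxWithin {n : ℕ} (f g : EuclideanSpace ℝ (Fin n) → ℝ) (ε : ℝ) : Prop :=
  eLpNorm (fun x => f x - g x) 2 (volume.restrict (unitCube n)) < ENNReal.ofReal ε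

namespace TwoLayerNetwork

variable {n Θ : ℕ}

/-- The parameters `c` of the potential zero-error hyperplanes `w_i · x + c = 0` of unit `i`, with
respect to the target `f` and the precision `ε`: they lie in the nonpositive half-space of
the hyperplane of the unit (`b_i ≤ c`), and truncation there keeps the precision. -/
def potentialZeroError (σ : ℝ → ℝ) (N : TwoLayerNetwork n Θ)
    (f : EuclideanSpace ℝ (Fin n) → ℝ) (ε : ℝ) (i : Fin Θ) : Set ℝ :=
  {c | (N.plane i).bias ≤ c ∧ ApproxWithin f (N.truncatedOutput σ i c) ε}

/-- `h` is the zero-error hyperplane of unit `i`: the extreme potential zero-error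
hyperplane in the direction of `w_i` (so its parameter `c` is the infimum), with the
orientation of the unit. Equations of `h` are taken up to a positive factor `ρ`. -/
def IsZeroErrorHyperplane (σ : ℝ → ℝ) (N : TwoLayerNetwork n Θ)
    (f : EuclideanSpace ℝ (Fin n) → ℝ) (ε : ℝ) (i : Fin Θ) (h : OrientedHyperplane n) : Prop :=
  ∃ ρ : ℝ, 0 < ρ ∧ (N.plane i).normal = ρ • h.normal ∧
    IsGLB (N.potentialZeroError σ f ε i) (ρ * h.bias)

/-- The network `N` approximates `f` with precision `ε`; its local units are derived from `H`,
one for each `h ∈ H`, whose zero-error hyperplane is `h`; all its other units are global, and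
come from universal global hyperplanes of the cube, at least `(n + m).choose m` in number. -/
structure RealizesFrom (σ : ℝ → ℝ) (m : ℕ) (H : Set (OrientedHyperplane n))
    (N : TwoLayerNetwork n Θ) (f : EuclideanSpace ℝ (Fin n) → ℝ) (ε : ℝ) : Prop where
  approx : ApproxWithin f (N.output σ) ε
  units : ∃ loc : H → Fin Θ, Function.Injective loc ∧
    (∀ h : H, N.IsZeroErrorHyperplane σ f ε (loc h) h) ∧
    (∀ i ∉ Set.range loc, (N.plane i).IsUniversalGlobal) ∧
    (n + m).choose m ≤ ((fun i => (N.plane i).carrier) '' (Set.range loc)ᶜ).ncard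

end TwoLayerNetwork

end

/-! The lower bound is a count. The regions are closures of cells, one for each choice of a layer in
every chain, so `ζ ≤ ∏ (k i + 1)` (`ncard_regions_le`). All cells are nonempty, so no hyperplane
occurs twice and `H` has exactly `∑ k i` elements (`FullCells.ncard_eq`), each with its own local
unit. The inequality of arithmetic and geometric means for the `k i + 1` then gives the bound
(`rpow_prod_sub_one_mul_le`), the global units contributing the binomial coefficient.

For existence, the spline is first written almost everywhere as `p + ∑ A i j * max (l i j) 0 ^ m`,
with `p` a polynomial of degree at most `m` (`FullCells.exists_truncatedPower_repr`). Across a face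
the two pieces differ by a multiple of the `m`-th power of the equation of the hyperplane, and going
round a square of four cells shows that the multiple is the same along the whole hyperplane.

Two cases follow. If `σ` is a polynomial on `(0, ∞)`, its degree is `m`; then `λ σ(ρ t)` with `ρ`
large is uniformly close to a given multiple of the truncated power
(`exists_abs_sub_truncatedPower_le`), and global units approximate `p` (`restrictPolynomial_mem`).
Otherwise global units are dense in the continuous functions on the cube (`globalClosure_eq_top`);
they approximate the whole spline, and the local units only need tiny weights. Both statements on
global units come from mollifying `σ` and differentiating `σ(w · x + b)` in `w`, which brings down
monomials in `x`.

In both cases each local unit is nearly zero on the negative side of its own hyperplane. Truncation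
there keeps the precision, so the zero-error hyperplane is the hyperplane of the unit
(`exists_realizesFrom`). -/

noncomputable section

/-! ### The cube and affine functions on it. -/

section Cube

variable {n : ℕ}

theorem isCompact_unitCube (n : ℕ) : IsCompact (unitCube n) := by
  have h : IsCompact (Set.univ.pi fun _ : Fin n => Set.Icc (0 : ℝ) 1) :=
    isCompact_univ_pi fun _ => isCompact_Icc
  convert h.image (PiLp.continuous_toLp 2 fun _ : Fin n => ℝ) using 1
  ext x
  constructor
  · intro hx
    exact ⟨x.ofLp, fun i _ => hx i, rfl⟩
  · rintro ⟨y, hy, rfl⟩ i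
    exact hy i trivial

theorem convex_unitCube (n : ℕ) : Convex ℝ (unitCube n) := by
  intro x hx y hy a b ha hb hab i
  exact (convex_Icc (0 : ℝ) 1) (hx i) (hy i) ha hb hab

namespace OrientedHyperplane

theorem eval_add (h : OrientedHyperplane n) (x v : EuclideanSpace ℝ (Fin n)) :
    h.eval (x + v) = h.eval x + inner ℝ h.normal v := by
  simp only [eval, inner_add_right]; ring

theorem eval_lineMap (h : OrientedHyperplane n) (x y : EuclideanSpace ℝ (Fin n)) (t : ℝ) :
    h.eval (x + t • (y - x)) = (1 - t) * h.eval x + t * h.eval y := by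
  simp only [eval, inner_add_right, inner_smul_right, inner_sub_right]; ring

@[fun_prop]
theorem continuous_eval (h : OrientedHyperplane n) : Continuous h.eval := by
  unfold eval; fun_prop

theorem convex_eval_pos (h : OrientedHyperplane n) : Convex ℝ {x | 0 < h.eval x} := by
  intro x hx y hy a b ha hb hab
  have : h.eval (a • x + b • y) = a * h.eval x + b * h.eval y := by
    simp only [eval, inner_add_right, inner_smul_right]
    linear_combination (-h.bias) * hab
  simp only [Set.mem_ofPred_eq] at hx hy ⊢
  rw [this]
  rcases ha.eq_or_lt with rfl | ha'
  · have : b = 1 := by linarith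
    subst this; linarith
  · nlinarith [mul_pos ha' hx, mul_nonneg hb hy.le]

theorem convex_eval_neg (h : OrientedHyperplane n) : Convex ℝ {x | h.eval x < 0} := by
  intro x hx y hy a b ha hb hab
  have : h.eval (a • x + b • y) = a * h.eval x + b * h.eval y := by
    simp only [eval, inner_add_right, inner_smul_right]
    linear_combination (-h.bias) * hab
  simp only [Set.mem_ofPred_eq] at hx hy ⊢
  rw [this]
  rcases ha.eq_or_lt with rfl | ha'
  · have : b = 1 := by linarith
    subst this; linarith
  · nlinarith [mul_pos ha' (neg_pos.2 hx), mul_nonneg hb (neg_pos.2 hy).le]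

end OrientedHyperplane

end Cube

/-! ### Cells, regions and their number. -/

section Cells

variable {n : ℕ} {k : Fin n → ℕ}

/-- The open cell of the cube in layer `c i` of each chain `l i`. -/
def cell (l : (i : Fin n) → Fin (k i) → OrientedHyperplane n) (c : Fin n → ℕ) :
    Set (EuclideanSpace ℝ (Fin n)) :=
  {x | x ∈ interior (unitCube n) ∧ ∀ (i : Fin n) (j : Fin (k i)),
    ((j : ℕ) < c i → 0 < (l i j).eval x) ∧ (c i ≤ (j : ℕ) → (l i j).eval x < 0)}

variable (l : (i : Fin n) → Fin (k i) → OrientedHyperplane n)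

theorem convex_cell (c : Fin n → ℕ) : Convex ℝ (cell l c) := by
  have : cell l c = interior (unitCube n) ∩ ⋂ (i : Fin n) (j : Fin (k i)),
      ((⋂ _ : (j : ℕ) < c i, {x | 0 < (l i j).eval x}) ∩
        ⋂ _ : c i ≤ (j : ℕ), {x | (l i j).eval x < 0}) := by
    ext x
    simp only [cell, Set.mem_ofPred_eq, Set.mem_inter_iff, Set.mem_iInter]
  rw [this]
  exact (convex_unitCube n).interior.inter <| convex_iInter fun i => convex_iInter fun j =>
    (convex_iInter fun _ => (l i j).convex_eval_pos).inter
      (convex_iInter fun _ => (l i j).convex_eval_neg)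

theorem cell_subset_diff (c : Fin n → ℕ) :
    cell l c ⊆ interior (unitCube n) \ ⋃ h ∈ {h | ∃ i j, h = l i j}, h.carrier := by
  intro x hx
  refine ⟨hx.1, ?_⟩
  simp only [Set.mem_iUnion, not_exists]
  rintro _ ⟨i, j, rfl⟩ (h0 : (l i j).eval x = 0)
  rcases lt_or_ge (j : ℕ) (c i) with h | h
  · exact ((hx.2 i j).1 h).ne' h0
  · exact ((hx.2 i j).2 h).ne h0

/-- A connected set avoiding all hyperplanes cannot change the sign of any equation, by the
intermediate value theorem; conversely a cell is convex, hence connected. -/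
theorem connectedComponentIn_eq_cell {c : Fin n → ℕ} {x : EuclideanSpace ℝ (Fin n)}
    (hx : x ∈ cell l c) :
    connectedComponentIn
      (interior (unitCube n) \ ⋃ h ∈ {h | ∃ i j, h = l i j}, h.carrier) x = cell l c := by
  apply Set.Subset.antisymm
  · set D := interior (unitCube n) \ ⋃ h ∈ {h | ∃ i j, h = l i j}, h.carrier with hD
    have hxD : x ∈ D := cell_subset_diff l c hx
    intro y hy
    have hsub := connectedComponentIn_subset D x
    have hpre : IsPreconnected (connectedComponentIn D x) := isPreconnected_connectedComponentIn
    have hne : ∀ z ∈ connectedComponentIn D x, ∀ i j, (l i j).eval z ≠ 0 := by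
      intro z hz i j h0
      refine (hsub hz).2 ?_
      simp only [Set.mem_iUnion]
      exact ⟨l i j, ⟨i, j, rfl⟩, h0⟩
    have hxx := mem_connectedComponentIn hxD
    refine ⟨(hsub hy).1, fun i j => ⟨fun h => ?_, fun h => ?_⟩⟩
    · by_contra hle
      obtain ⟨z, hz, hz0⟩ := hpre.intermediate_value hy hxx
        (l i j).continuous_eval.continuousOn ⟨not_lt.1 hle, ((hx.2 i j).1 h).le⟩
      exact hne z hz i j hz0
    · by_contra hle
      obtain ⟨z, hz, hz0⟩ := hpre.intermediate_value hxx hy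
        (l i j).continuous_eval.continuousOn ⟨((hx.2 i j).2 h).le, not_lt.1 hle⟩
      exact hne z hz i j hz0
  · exact (convex_cell l c).isPreconnected.subset_connectedComponentIn hx (cell_subset_diff l c)

theorem closure_cell_mem_regions {c : Fin n → ℕ} (hc : (cell l c).Nonempty) :
    closure (cell l c) ∈ regions {h | ∃ i j, h = l i j} := by
  obtain ⟨x, hx⟩ := hc
  exact ⟨x, cell_subset_diff l c hx, by rw [connectedComponentIn_eq_cell l hx]⟩

theorem exists_mem_cell (hl : ∀ i j j', j < j' → (l i j).Precedes (l i j'))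
    {x : EuclideanSpace ℝ (Fin n)}
    (hx : x ∈ interior (unitCube n) \ ⋃ h ∈ {h | ∃ i j, h = l i j}, h.carrier) :
    ∃ c : Fin n → ℕ, c ≤ k ∧ x ∈ cell l c := by
  classical
  have hne : ∀ i j, (l i j).eval x ≠ 0 := by
    intro i j h0
    refine hx.2 ?_
    simp only [Set.mem_iUnion]
    exact ⟨l i j, ⟨i, j, rfl⟩, h0⟩
  -- Along a chain the positive sides decrease, so the signs at `x` are positive up to some index
  -- and negative after it; that index is the layer.
  have hlow : ∀ i j j', j ≤ j' → 0 < (l i j').eval x → 0 < (l i j).eval x := by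
    intro i j j' hjj h
    rcases hjj.eq_or_lt with rfl | hlt
    · exact h
    · have h1 : x ∈ unitCube n ∩ (l i j').pos := ⟨interior_subset hx.1, h.le⟩
      have h2 : 0 ≤ (l i j).eval x := ((hl i j j' hlt).1 h1).2
      exact h2.lt_of_ne (hne i j).symm
  have hex : ∀ i, ∃ b : ℕ, ∀ j : Fin (k i), 0 < (l i j).eval x → (j : ℕ) < b :=
    fun i => ⟨k i, fun j _ => j.2⟩
  refine ⟨fun i => Nat.find (hex i), fun i => Nat.find_min' (hex i) fun j _ => j.2, hx.1,
    fun i j => ⟨fun h => ?_, fun h => ?_⟩⟩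
  · have := Nat.find_min (hex i) h
    push Not at this
    obtain ⟨j', h1, h2⟩ := this
    exact hlow i j j' (Fin.le_def.2 h2) h1
  · refine lt_of_le_of_ne (not_lt.1 fun h0 => ?_) (hne i j)
    exact absurd (Nat.find_spec (hex i) j h0) (not_lt.2 h)

theorem regions_subset_range (hl : ∀ i j j', j < j' → (l i j).Precedes (l i j')) :
    regions {h | ∃ i j, h = l i j} ⊆
      Set.range fun c : (i : Fin n) → Fin (k i + 1) => closure (cell l fun i => c i) := by
  rintro R ⟨x, hx, rfl⟩
  obtain ⟨c, hck, hc⟩ := exists_mem_cell l hl hx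
  refine ⟨fun i => ⟨c i, Nat.lt_succ_of_le (hck i)⟩, ?_⟩
  rw [connectedComponentIn_eq_cell l hc]

theorem finite_regions (hl : ∀ i j j', j < j' → (l i j).Precedes (l i j')) :
    (regions {h | ∃ i j, h = l i j}).Finite :=
  (Set.finite_range _).subset (regions_subset_range l hl)

theorem ncard_regions_le (hl : ∀ i j j', j < j' → (l i j).Precedes (l i j')) :
    (regions {h | ∃ i j, h = l i j}).ncard ≤ ∏ i, (k i + 1) := by
  classical
  refine (Set.ncard_le_ncard (regions_subset_range l hl) (Set.finite_range _)).trans ?_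
  rw [← Set.image_univ]
  refine (Set.ncard_image_le Set.finite_univ).trans ?_
  simp [Set.ncard_univ]

/-- Every choice of one layer of each chain gives a nonempty cell. -/
def FullCells : Prop := ∀ c : Fin n → ℕ, c ≤ k → (cell l c).Nonempty

variable {l}

theorem FullCells.injective (hne : FullCells l) :
    Function.Injective fun p : (i : Fin n) × Fin (k i) => l p.1 p.2 := by
  classical
  rintro ⟨i, j⟩ ⟨i', j'⟩ (h : l i j = l i' j')
  by_contra hneq
  -- A cell lying on opposite sides of the two hyperplanes shows that they differ, since all cells
  -- are nonempty.
  suffices ∃ c : Fin n → ℕ, c ≤ k ∧ (((j : ℕ) < c i ∧ c i' ≤ j') ∨ (c i ≤ j ∧ (j' : ℕ) < c i')) by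
    obtain ⟨c, hck, hc⟩ := this
    obtain ⟨x, hx⟩ := hne c hck
    rcases hc with ⟨h1, h2⟩ | ⟨h1, h2⟩
    · have := (hx.2 i j).1 h1
      have := (hx.2 i' j').2 h2
      rw [h] at *; linarith
    · have := (hx.2 i j).2 h1
      have := (hx.2 i' j').1 h2
      rw [h] at *; linarith
  by_cases hii : i = i'
  · subst hii
    have hjj : (j : ℕ) ≠ j' := fun h => hneq (by rw [Fin.ext h])
    rcases lt_or_gt_of_ne hjj with h | h
    · refine ⟨Function.update 0 i j', ?_, Or.inl ?_⟩
      · intro a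
        by_cases ha : a = i
        · subst ha; simp
        · simp [ha]
      · simp [h]
    · refine ⟨Function.update 0 i j, ?_, Or.inr ?_⟩
      · intro a
        by_cases ha : a = i
        · subst ha; simp
        · simp [ha]
      · simp [h]
  · refine ⟨Function.update 0 i (k i), ?_, Or.inl ?_⟩
    · intro a
      by_cases ha : a = i
      · subst ha; simp
      · simp [ha]
    · simp [Ne.symm hii]

theorem FullCells.ncard_eq (hne : FullCells l) :
    Set.ncard {h | ∃ i j, h = l i j} = ∑ i, k i := by
  have : {h | ∃ i j, h = l i j} = (fun p : (i : Fin n) × Fin (k i) => l p.1 p.2) '' Set.univ := by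
    ext h
    simp [eq_comm]
  rw [this, Set.ncard_image_of_injective _ hne.injective, Set.ncard_univ]
  simp

end Cells

/-! ### The counting inequalities. -/

theorem rpow_prod_sub_one_mul_le {n : ℕ} (hn : n ≠ 0) (k : Fin n → ℕ) {z : ℕ}
    (hz : z ≤ ∏ i, (k i + 1)) :
    ((z : ℝ) ^ (1 / (n : ℝ)) - 1) * n ≤ ((∑ i, k i : ℕ) : ℝ) := by
  have hn' : (0 : ℝ) < n := by positivity
  have h1 : (z : ℝ) ^ (1 / (n : ℝ)) ≤ (∏ i, ((k i : ℝ) + 1)) ^ (1 / (n : ℝ)) := by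
    apply Real.rpow_le_rpow (by positivity) _ (by positivity)
    exact_mod_cast hz
  have h2 := Real.geom_mean_le_arith_mean_weighted Finset.univ (fun _ : Fin n => 1 / (n : ℝ))
    (fun i => (k i : ℝ) + 1) (fun _ _ => by positivity) (by simp [hn]) (fun _ _ => by positivity)
  rw [Real.finsetProd_rpow _ _ fun _ _ => by positivity, ← Finset.mul_sum,
    Finset.sum_add_distrib] at h2
  simp only [Finset.sum_const, Finset.card_univ, Fintype.card_fin, nsmul_eq_mul, mul_one] at h2
  have h3 := mul_le_mul_of_nonneg_right (h1.trans h2) hn'.le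
  rw [mul_right_comm, one_div, inv_mul_cancel₀ hn'.ne', one_mul] at h3
  push_cast
  rw [one_div]
  linarith

theorem TwoLayerNetwork.RealizesFrom.ncard_add_choose_le {n Θ m : ℕ} {σ : ℝ → ℝ}
    {H : Set (OrientedHyperplane n)} {N : TwoLayerNetwork n Θ}
    {f : EuclideanSpace ℝ (Fin n) → ℝ} {ε : ℝ} (h : N.RealizesFrom σ m H f ε) :
    H.ncard + (n + m).choose m ≤ Θ := by
  obtain ⟨loc, hinj, -, -, hcard⟩ := h.units
  have h1 : (Set.range loc).ncard = H.ncard := by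
    rw [← Set.image_univ, Set.ncard_image_of_injective _ hinj, Set.ncard_univ]
    rfl
  have h2 := Set.ncard_image_le (f := fun i => (N.plane i).carrier) (Set.toFinite (Set.range loc)ᶜ)
  have h3 := Set.ncard_add_ncard_compl (Set.range loc)
  simp only [Nat.card_eq_fintype_card, Fintype.card_fin] at h3
  omega

/-! ### Polynomials that agree to order `m - 1` along a hyperplane. -/

section Jump

variable {n : ℕ}

theorem continuous_polyEval (p : MvPolynomial (Fin n) ℝ) : Continuous (polyEval p) :=
  (MvPolynomial.continuous_eval p).comp (PiLp.continuous_ofLp 2 fun _ : Fin n => ℝ)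

theorem exists_polynomial_eval_line (p : MvPolynomial (Fin n) ℝ)
    (x d : EuclideanSpace ℝ (Fin n)) :
    ∃ P : Polynomial ℝ, P.natDegree ≤ p.totalDegree ∧
      ∀ t, P.eval t = polyEval p (x + t • d) := by
  refine ⟨MvPolynomial.aeval (fun i => Polynomial.C (d i) * Polynomial.X + Polynomial.C (x i)) p,
    ?_, fun t => ?_⟩
  · simpa using MvPolynomial.aeval_natDegree_le p le_rfl _ (n := 1)
      fun i => Polynomial.natDegree_linear_le
  · rw [← Polynomial.coe_evalRingHom, MvPolynomial.map_aeval, polyEval, MvPolynomial.eval,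
      MvPolynomial.coe_eval₂Hom, MvPolynomial.coe_eval₂Hom]
    congr 1
    · ext; simp
    · ext i; simp; ring

theorem iteratedDeriv_polynomial_eval_zero (P : Polynomial ℝ) (k : ℕ) :
    iteratedDeriv k (fun t => P.eval t) 0 = k.factorial * P.coeff k := by
  have h : iteratedDeriv k (fun t => P.eval t) =
      fun t => (Polynomial.derivative^[k] P).eval t := by
    induction k with
    | zero => simp
    | succ k ih =>
      rw [iteratedDeriv_succ, ih, Function.iterate_succ_apply']
      ext t
      exact Polynomial.deriv _
  rw [h]
  simp only [← Polynomial.coeff_zero_eq_eval_zero, Polynomial.coeff_iterate_derivative, zero_add,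
    Nat.descFactorial_self, nsmul_eq_mul]

/-- On the line the difference is a polynomial in `t` of degree at most `m` whose coefficients below
`m` vanish; its value at `t = 1` is the remaining coefficient. -/
theorem polyEval_sub_eq_pow_mul {m : ℕ} {p q : MvPolynomial (Fin n) ℝ}
    (hp : p.totalDegree ≤ m) (hq : q.totalDegree ≤ m) {x d : EuclideanSpace ℝ (Fin n)}
    (h : ∀ k < m, iteratedDeriv k (fun t : ℝ => polyEval p (x + t • d)) 0 =
      iteratedDeriv k (fun t : ℝ => polyEval q (x + t • d)) 0) (t : ℝ) :
    polyEval q (x + t • d) - polyEval p (x + t • d) =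
      t ^ m * (polyEval q (x + d) - polyEval p (x + d)) := by
  obtain ⟨P, hP, hPe⟩ := exists_polynomial_eval_line p x d
  obtain ⟨Q, hQ, hQe⟩ := exists_polynomial_eval_line q x d
  have hcoeff : ∀ k < m, (Q - P).coeff k = 0 := by
    intro k hk
    have := h k hk
    simp only [← hPe, ← hQe, iteratedDeriv_polynomial_eval_zero] at this
    rw [Polynomial.coeff_sub, sub_eq_zero]
    exact (mul_left_cancel₀ (Nat.cast_ne_zero.2 k.factorial_ne_zero) this).symm
  have hdeg : (Q - P).natDegree < m + 1 :=
    Nat.lt_succ_of_le ((Polynomial.natDegree_sub_le _ _).trans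
      (max_le (hQ.trans hq) (hP.trans hp)))
  have heval : ∀ t, (Q - P).eval t = (Q - P).coeff m * t ^ m := by
    intro t
    rw [Polynomial.eval_eq_sum_range' hdeg, Finset.sum_range_succ, Finset.sum_eq_zero, zero_add]
    intro k hk
    rw [hcoeff k (Finset.mem_range.1 hk), zero_mul]
  have h1 := heval 1
  have ht := heval t
  rw [Polynomial.eval_sub, hPe, hQe] at h1 ht
  rw [one_smul, one_pow, mul_one] at h1
  rw [ht, h1, mul_comm]

/-- A continuous function that is homogeneous of degree `m` about every point of a hyperplane
near `z`, in the directions transversal to it, is a multiple of the `m`-th power of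
the equation of the hyperplane. -/
theorem eq_mul_eval_pow_of_homogeneous {m : ℕ} {f : EuclideanSpace ℝ (Fin n) → ℝ}
    (hf : Continuous f) (h : OrientedHyperplane n) {z : EuclideanSpace ℝ (Fin n)}
    (hz : h.eval z = 0) {r : ℝ} (hr : 0 < r)
    (hhom : ∀ u, inner ℝ h.normal u = 0 → ‖u‖ < r → ∀ d, inner ℝ h.normal d ≠ 0 → ∀ t : ℝ,
      f (z + u + t • d) = t ^ m * f (z + u + d)) :
    ∃ a : ℝ, ∀ x, f x = a * h.eval x ^ m := by
  have hdense : Dense ({0}ᶜ : Set ℝ) := dense_compl_singleton 0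
  have hhom0 : ∀ d, inner ℝ h.normal d ≠ 0 → ∀ t : ℝ, f (z + t • d) = t ^ m * f (z + d) := by
    intro d hd t
    simpa using hhom 0 (by simp) (by simpa using hr) d hd t
  have step1 : ∀ u, inner ℝ h.normal u = 0 → ‖u‖ < r → ∀ d, inner ℝ h.normal d ≠ 0 →
      f (z + u + d) = f (z + d) := by
    intro u hu hur d hd
    -- For `s ≠ 0`, dilating `z + u + (d - s • u)` about `z + u` and `z + d` about `z`, both by
    -- `s⁻¹`, gives the same point. Continuity carries the equality to `s = 0`.
    have hc : (fun s : ℝ => f (z + u + (d - s • u))) = fun _ => f (z + d) := by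
      refine Continuous.ext_on hdense (by fun_prop) (by fun_prop) ?_
      intro s hs
      have hs' : s ≠ 0 := hs
      have h1 := hhom u hu hur (d - s • u)
        (by rw [inner_sub_right, inner_smul_right, hu]; simpa using hd) s⁻¹
      have h2 := hhom0 d hd s⁻¹
      have h3 : z + u + s⁻¹ • (d - s • u) = z + s⁻¹ • d := by
        rw [smul_sub, smul_smul, inv_mul_cancel₀ hs', one_smul]; abel
      rw [h3, h2] at h1
      exact (mul_left_cancel₀ (pow_ne_zero _ (inv_ne_zero hs')) h1).symm
    simpa using congrFun hc 0
  -- Homogeneity about `z` shrinks any tangential `u` below the radius `r`.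
  have step2 : ∀ u, inner ℝ h.normal u = 0 → ∀ d, inner ℝ h.normal d ≠ 0 →
      f (z + (d + u)) = f (z + d) := by
    intro u hu d hd
    obtain ⟨s, hs, hsr⟩ : ∃ s : ℝ, 0 < s ∧ s * ‖u‖ < r := by
      refine ⟨r / (‖u‖ + 1), by positivity, ?_⟩
      rw [div_mul_eq_mul_div, div_lt_iff₀ (by positivity)]
      nlinarith [norm_nonneg u]
    have h1 := hhom0 (d + u) (by rw [inner_add_right, hu]; simpa using hd) s
    have h2 := hhom0 d hd s
    have h3 := step1 (s • u) (by rw [inner_smul_right, hu, mul_zero])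
      (by rw [norm_smul, Real.norm_of_nonneg hs.le]; exact hsr) (s • d)
      (by rw [inner_smul_right]; exact mul_ne_zero hs.ne' hd)
    have h4 : z + s • (d + u) = z + s • u + s • d := by rw [smul_add]; abel
    rw [h4, h3, h2] at h1
    exact (mul_left_cancel₀ (pow_ne_zero _ hs.ne') h1).symm
  have hw : inner ℝ h.normal h.normal ≠ (0 : ℝ) := by
    simpa using h.normal_ne
  set W : ℝ := inner ℝ h.normal h.normal with hW
  have step3 : ∀ x, h.eval x ≠ 0 → f x = f (z + h.normal) / W ^ m * h.eval x ^ m := by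
    intro x hx
    set s : ℝ := h.eval x / W with hs
    have hs0 : s ≠ 0 := div_ne_zero hx hw
    have hu : inner ℝ h.normal (x - z - s • h.normal) = 0 := by
      have h1 := h.eval_add z (x - z)
      rw [add_sub_cancel, hz, zero_add] at h1
      rw [inner_sub_right, ← h1, inner_smul_right, ← hW, hs, div_mul_cancel₀ _ hw, sub_self]
    have h2 := step2 _ hu (s • h.normal) (by
      rw [inner_smul_right]; exact mul_ne_zero hs0 hw)
    have h3 : z + (s • h.normal + (x - z - s • h.normal)) = x := by abel
    rw [h3, hhom0 _ hw] at h2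
    rw [h2, hs, div_pow]
    ring
  refine ⟨f (z + h.normal) / W ^ m, fun x => ?_⟩
  by_cases hx : h.eval x = 0
  -- On the hyperplane itself the formula is the limit along the normal.
  · have hc : (fun s : ℝ => f (x + s • h.normal)) =
        fun s : ℝ => f (z + h.normal) / W ^ m * h.eval (x + s • h.normal) ^ m := by
      refine Continuous.ext_on hdense (by fun_prop) (by fun_prop) ?_
      intro s hs
      refine step3 _ ?_
      rw [h.eval_add, hx, zero_add, inner_smul_right]
      exact mul_ne_zero hs hw
    simpa using congrFun hc 0
  · exact step3 x hx

end Jump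

/-! ### Faces between cells and the truncated-power form of a spline. -/

section Faces

variable {n : ℕ} {k : Fin n → ℕ} {l : (i : Fin n) → Fin (k i) → OrientedHyperplane n}

theorem OrientedHyperplane.mem_closure_neg_of_mem_ball (h : OrientedHyperplane n)
    {z y : EuclideanSpace ℝ (Fin n)} {r : ℝ} (hy : y ∈ Metric.ball z r) (h0 : h.eval y = 0) :
    y ∈ closure (Metric.ball z r ∩ {x | h.eval x < 0}) := by
  have hw : 0 < (inner ℝ h.normal h.normal : ℝ) := real_inner_self_pos.2 h.normal_ne
  have ht : Tendsto (fun s : ℝ => y + s • h.normal) (𝓝[<] 0) (𝓝 y) := by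
    have : Continuous fun s : ℝ => y + s • h.normal := by fun_prop
    simpa using (this.tendsto 0).mono_left nhdsWithin_le_nhds
  refine mem_closure_of_tendsto ht ?_
  filter_upwards [ht (Metric.isOpen_ball.mem_nhds hy), self_mem_nhdsWithin] with s hs hs0
  refine ⟨hs, ?_⟩
  change h.eval _ < 0
  rw [h.eval_add, h0, inner_smul_right, zero_add]
  exact mul_neg_of_neg_of_pos hs0 hw

theorem OrientedHyperplane.mem_closure_pos_of_mem_ball (h : OrientedHyperplane n)
    {z y : EuclideanSpace ℝ (Fin n)} {r : ℝ} (hy : y ∈ Metric.ball z r) (h0 : h.eval y = 0) :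
    y ∈ closure (Metric.ball z r ∩ {x | 0 < h.eval x}) := by
  have hw : 0 < (inner ℝ h.normal h.normal : ℝ) := real_inner_self_pos.2 h.normal_ne
  have ht : Tendsto (fun s : ℝ => y + s • h.normal) (𝓝[>] 0) (𝓝 y) := by
    have : Continuous fun s : ℝ => y + s • h.normal := by fun_prop
    simpa using (this.tendsto 0).mono_left nhdsWithin_le_nhds
  refine mem_closure_of_tendsto ht ?_
  filter_upwards [ht (Metric.isOpen_ball.mem_nhds hy), self_mem_nhdsWithin] with s hs hs0
  refine ⟨hs, ?_⟩
  change 0 < h.eval _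
  rw [h.eval_add, h0, inner_smul_right, zero_add]
  exact mul_pos hs0 hw

/-- The cells on both sides of `l i j` meet along a piece of it. -/
theorem FullCells.exists_face (hne : FullCells l) {c : Fin n → ℕ} (hc : c ≤ k) {i : Fin n}
    (hi : c i < k i) :
    ∃ z, ∃ r > 0, (l i ⟨c i, hi⟩).eval z = 0 ∧
      (∀ i' j', i' ≠ i → (l i' j').eval z ≠ 0) ∧
      Metric.ball z r ∩ {x | (l i ⟨c i, hi⟩).eval x < 0} ⊆ cell l c ∧
      Metric.ball z r ∩ {x | 0 < (l i ⟨c i, hi⟩).eval x} ⊆ cell l (c + Pi.single i 1) := by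
  classical
  set c' := c + Pi.single i 1 with hc'
  have hci : c' i = c i + 1 := by simp [hc']
  have hci' : ∀ i', i' ≠ i → c' i' = c i' := fun i' h => by simp [hc', h]
  have hc'k : c' ≤ k := by
    intro i'
    by_cases h : i' = i
    · subst h; rw [hci]; exact hi
    · rw [hci' _ h]; exact hc i'
  set L := l i ⟨c i, hi⟩ with hL
  obtain ⟨x, hx⟩ := hne c hc
  obtain ⟨y, hy⟩ := hne c' hc'k
  have hLx : L.eval x < 0 := (hx.2 i ⟨c i, hi⟩).2 le_rfl
  have hLy : 0 < L.eval y := (hy.2 i ⟨c i, hi⟩).1 (by rw [hci]; exact Nat.lt_succ_self _)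
  -- `z` is the point where the segment from `x` to `y` crosses `L`. Every other hyperplane has the
  -- same strict sign at both ends, hence at `z` and on a ball around it.
  set t : ℝ := L.eval x / (L.eval x - L.eval y) with ht
  have hden : L.eval x - L.eval y < 0 := by linarith
  have ht0 : 0 < t := div_pos_of_neg_of_neg hLx hden
  have ht1 : t < 1 := by rw [ht, div_lt_one_of_neg hden]; linarith
  set z := x + t • (y - x) with hz
  have hLz : L.eval z = 0 := by
    rw [hz, L.eval_lineMap, ht]; field_simp [hden.ne]; ring
  have hzint : z ∈ interior (unitCube n) :=
    (convex_unitCube n).interior.add_smul_sub_mem hx.1 hy.1 ⟨ht0.le, ht1.le⟩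
  have hpos : ∀ i' (j' : Fin (k i')), (j' : ℕ) < c i' → 0 < (l i' j').eval z := by
    intro i' j' h
    have h1 := (hx.2 i' j').1 h
    have h2 := (hy.2 i' j').1 (lt_of_lt_of_le h (by
      by_cases e : i' = i
      · subst e; rw [hci]; exact Nat.le_succ _
      · rw [hci' _ e]))
    rw [hz, OrientedHyperplane.eval_lineMap]
    nlinarith [mul_pos (sub_pos.2 ht1) h1, mul_pos ht0 h2]
  have hneg : ∀ i' (j' : Fin (k i')), c' i' ≤ (j' : ℕ) → (l i' j').eval z < 0 := by
    intro i' j' h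
    have h1 := (hx.2 i' j').2 (le_trans (by
      by_cases e : i' = i
      · subst e; rw [hci]; exact Nat.le_succ _
      · rw [hci' _ e]) h)
    have h2 := (hy.2 i' j').2 h
    rw [hz, OrientedHyperplane.eval_lineMap]
    nlinarith [mul_pos (sub_pos.2 ht1) (neg_pos.2 h1), mul_pos ht0 (neg_pos.2 h2)]
  have hev : ∀ᶠ v in 𝓝 z, v ∈ interior (unitCube n) ∧ ∀ i' (j' : Fin (k i')),
      ((j' : ℕ) < c i' → 0 < (l i' j').eval v) ∧ (c' i' ≤ (j' : ℕ) → (l i' j').eval v < 0) := by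
    refine Eventually.and (isOpen_interior.mem_nhds hzint) ?_
    refine eventually_all.2 fun i' => eventually_all.2 fun j' => ?_
    refine (eventually_imp_distrib_left.2 fun h => ?_).and
      (eventually_imp_distrib_left.2 fun h => ?_)
    · exact (l i' j').continuous_eval.continuousAt.eventually_const_lt (hpos i' j' h)
    · exact (l i' j').continuous_eval.continuousAt.eventually_lt_const (hneg i' j' h)
  obtain ⟨r, hr, hball⟩ := Metric.eventually_nhds_iff_ball.1 hev
  refine ⟨z, r, hr, hLz, ?_, ?_, ?_⟩
  · intro i' j' hne'
    rcases lt_or_ge (j' : ℕ) (c i') with h | h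
    · exact (hpos i' j' h).ne'
    · exact (hneg i' j' (by rwa [hci' _ hne'])).ne
  · rintro v ⟨hv, hvL⟩
    obtain ⟨h1, h2⟩ := hball v hv
    refine ⟨h1, fun i' j' => ⟨(h2 i' j').1, fun h => ?_⟩⟩
    by_cases e : i' = i
    · subst e
      rcases h.eq_or_lt with e' | e'
      · have : j' = ⟨c i', hi⟩ := Fin.ext e'.symm
        rw [this]; exact hvL
      · exact (h2 i' j').2 (by rw [hci]; exact e')
    · exact (h2 i' j').2 (by rwa [hci' _ e])
  · rintro v ⟨hv, hvL⟩
    obtain ⟨h1, h2⟩ := hball v hv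
    refine ⟨h1, fun i' j' => ⟨fun h => ?_, (h2 i' j').2⟩⟩
    by_cases e : i' = i
    · subst e
      rw [hci] at h
      rcases (Nat.lt_succ_iff.1 h).eq_or_lt with e' | e'
      · have : j' = ⟨c i', hi⟩ := Fin.ext e'
        rw [this]; exact hvL
      · exact (h2 i' j').1 e'
    · exact (h2 i' j').1 (by rwa [hci' _ e] at h)

theorem closure_cell_subset_neg {c : Fin n → ℕ} {i : Fin n} {j : Fin (k i)} (h : c i ≤ j) :
    closure (cell l c) ⊆ (l i j).neg :=
  closure_minimal (fun _ hx => ((hx.2 i j).2 h).le)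
    (isClosed_le (l i j).continuous_eval continuous_const)

theorem closure_cell_subset_pos {c : Fin n → ℕ} {i : Fin n} {j : Fin (k i)} (h : (j : ℕ) < c i) :
    closure (cell l c) ⊆ (l i j).pos :=
  closure_minimal (fun _ hx => ((hx.2 i j).1 h).le)
    (isClosed_le continuous_const (l i j).continuous_eval)

theorem OrientedHyperplane.finrank_vectorSpan {h : OrientedHyperplane n}
    {A : Set (EuclideanSpace ℝ (Fin n))} (hA : A ⊆ h.carrier)
    {z : EuclideanSpace ℝ (Fin n)} {r : ℝ} (hr : 0 < r) (hz : h.eval z = 0)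
    (hball : ∀ y ∈ Metric.ball z r, h.eval y = 0 → y ∈ A) :
    Module.finrank ℝ (vectorSpan ℝ A) = n - 1 := by
  have hspan : vectorSpan ℝ A = (ℝ ∙ h.normal)ᗮ := by
    apply le_antisymm
    · rw [vectorSpan_def, Submodule.span_le]
      rintro _ ⟨x, hx, y, hy, rfl⟩
      rw [SetLike.mem_coe, Submodule.mem_orthogonal_singleton_iff_inner_right]
      have h1 := h.eval_add y (x - y)
      have hx0 : h.eval x = 0 := hA hx
      have hy0 : h.eval y = 0 := hA hy
      rw [add_sub_cancel, hx0, hy0, zero_add] at h1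
      simpa using h1.symm
    · intro u hu
      rw [Submodule.mem_orthogonal_singleton_iff_inner_right] at hu
      obtain ⟨s, hs, hsr⟩ : ∃ s : ℝ, 0 < s ∧ s * ‖u‖ < r := by
        refine ⟨r / (‖u‖ + 1), by positivity, ?_⟩
        rw [div_mul_eq_mul_div, div_lt_iff₀ (by positivity)]
        nlinarith [norm_nonneg u]
      have h1 : z + s • u ∈ A := by
        apply hball
        · simpa [norm_smul, abs_of_pos hs] using hsr
        · rw [h.eval_add, hz, inner_smul_right, hu, mul_zero, add_zero]
      have h2 : z ∈ A := hball z (Metric.mem_ball_self hr) hz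
      have h3 := vsub_mem_vectorSpan ℝ h1 h2
      rw [vsub_eq_sub, add_sub_cancel_left] at h3
      have h4 := (vectorSpan ℝ A).smul_mem s⁻¹ h3
      rwa [smul_smul, inv_mul_cancel₀ hs.ne', one_smul] at h4
  rw [hspan]
  have h1 := (ℝ ∙ h.normal).finrank_add_finrank_orthogonal
  rw [finrank_span_singleton h.normal_ne, finrank_euclideanSpace, Fintype.card_fin] at h1
  omega

/-- The polynomial pieces of a spline on neighbouring cells differ by a multiple of the `m`-th
power of the equation of the separating hyperplane. -/
theorem FullCells.exists_jump (hne : FullCells l) {m : ℕ}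
    {p : Set (EuclideanSpace ℝ (Fin n)) → MvPolynomial (Fin n) ℝ}
    (hdeg : ∀ R ∈ regions {h | ∃ i j, h = l i j}, (p R).totalDegree ≤ m)
    (hp : ∀ R ∈ regions {h | ∃ i j, h = l i j}, ∀ R' ∈ regions {h | ∃ i j, h = l i j},
      AdjacentRegions R R' → ∀ h ∈ {h | ∃ i j, h = l i j}, R ∩ R' ⊆ h.carrier →
        SmoothlyContinuousAt m h (R ∩ R') (p R) (p R'))
    {c : Fin n → ℕ} (hc : c ≤ k) {i : Fin n} (hi : c i < k i) :
    ∃ a : ℝ, ∀ x, polyEval (p (closure (cell l (c + Pi.single i 1)))) x =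
      polyEval (p (closure (cell l c))) x + a * (l i ⟨c i, hi⟩).eval x ^ m := by
  obtain ⟨z, r, hr, hz, -, h1, h2⟩ := hne.exists_face hc hi
  set L := l i ⟨c i, hi⟩
  set R := closure (cell l c) with hR
  set R' := closure (cell l (c + Pi.single i 1)) with hR'
  have hc' : c + Pi.single i 1 ≤ k := by
    intro i'
    by_cases h : i' = i
    · subst h; simpa using hi
    · simpa [h] using hc i'
  have hRm := closure_cell_mem_regions l (hne c hc)
  have hRm' := closure_cell_mem_regions l (hne _ hc')
  have hneg : R ⊆ L.neg := closure_cell_subset_neg le_rfl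
  have hpos : R' ⊆ L.pos := closure_cell_subset_pos (by simp)
  have hcar : R ∩ R' ⊆ L.carrier := fun x hx => le_antisymm (hneg hx.1) (hpos hx.2)
  have hball : ∀ y ∈ Metric.ball z r, L.eval y = 0 → y ∈ R ∩ R' := fun y hy h0 =>
    ⟨closure_mono h1 (L.mem_closure_neg_of_mem_ball hy h0),
      closure_mono h2 (L.mem_closure_pos_of_mem_ball hy h0)⟩
  have hadj : AdjacentRegions R R' := by
    refine ⟨fun h => ?_, OrientedHyperplane.finrank_vectorSpan hcar hr hz hball⟩
    obtain ⟨x, hx⟩ := hne c hc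
    have hx1 : L.eval x < 0 := (hx.2 i ⟨c i, hi⟩).2 le_rfl
    have hx2 : x ∈ R' := h ▸ subset_closure hx
    exact absurd (hpos hx2) (not_le.2 hx1)
  have hsm := hp R hRm R' hRm' hadj L ⟨i, _, rfl⟩ hcar
  obtain ⟨a, ha⟩ := eq_mul_eval_pow_of_homogeneous (m := m)
    (f := fun x => polyEval (p R') x - polyEval (p R) x)
    ((continuous_polyEval _).sub (continuous_polyEval _)) L hz hr (by
      intro u hu hur d hd t
      refine polyEval_sub_eq_pow_mul (hdeg R hRm) (hdeg R' hRm') ?_ t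
      intro k hk
      refine hsm (z + u) (hball _ ?_ ?_) d hd k hk
      · simpa using hur
      · rw [L.eval_add, hz, hu, add_zero])
  exact ⟨a, fun x => by linarith [ha x]⟩

/-- Functions on a box of indices whose increments in direction `i` are multiples of functions
`φ i j` depending only on the `i`-th index `j` are sums of such multiples. -/
theorem exists_eq_add_sum_of_increments {X : Type*} (f : (Fin n → ℕ) → X → ℝ)
    (φ : Fin n → ℕ → X → ℝ)
    (hjump : ∀ c ≤ k, ∀ i, c i < k i →
      ∃ a : ℝ, ∀ x, f (c + Pi.single i 1) x = f c x + a * φ i (c i) x)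
    (hsep : ∀ i i' j j', i ≠ i' → j < k i → j' < k i' → ∃ x, φ i j x = 0 ∧ φ i' j' x ≠ 0) :
    ∃ A : Fin n → ℕ → ℝ, ∀ c ≤ k, ∀ x,
      f c x = f 0 x + ∑ i, ∑ j ∈ Finset.range (c i), A i j * φ i j x := by
  classical
  -- The coefficients are read off along the axes of the box, where all other indices are zero.
  have hA : ∀ i j, ∃ a : ℝ, j < k i → ∀ x,
      f (Pi.single i j + Pi.single i 1) x = f (Pi.single i j) x + a * φ i j x := by
    intro i j
    by_cases hj : j < k i
    · obtain ⟨a, ha⟩ := hjump (Pi.single i j) (fun i' => by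
        by_cases h : i' = i
        · subst h; simpa using hj.le
        · simp [h]) i (by simpa using hj)
      exact ⟨a, fun _ x => by simpa using ha x⟩
    · exact ⟨0, fun h => absurd h hj⟩
  choose A hA using hA
  set G : (Fin n → ℕ) → X → ℝ := fun c x => ∑ i, ∑ j ∈ Finset.range (c i), A i j * φ i j x
    with hG
  have hGs : ∀ (c : Fin n → ℕ) (i : Fin n) x, G (c + Pi.single i 1) x = G c x + A i (c i) * φ i (c i) x := by
    intro c i x
    simp only [hG]
    rw [← Finset.add_sum_erase _ _ (Finset.mem_univ i),
      ← Finset.add_sum_erase (a := i) (s := Finset.univ)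
        (f := fun i => ∑ j ∈ Finset.range (c i), A i j * φ i j x) (h := Finset.mem_univ i)]
    rw [Finset.sum_congr rfl (g := fun i' => ∑ j ∈ Finset.range (c i'), A i' j * φ i' j x)
      fun i' hi' => by simp [Finset.ne_of_mem_erase hi']]
    simp only [Pi.add_apply, Pi.single_eq_same, Finset.sum_range_succ]
    ring
  refine ⟨A, fun c => ?_⟩
  induction hN : ∑ i, c i using Nat.strong_induction_on generalizing c with
  | _ N ih =>
  intro hc x
  change f c x = f 0 x + G c x
  have ih' : ∀ (d : Fin n → ℕ) (i : Fin n), d + Pi.single i 1 ≤ c → ∀ x, f d x = f 0 x + G d x := by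
    intro d i hd x
    refine ih _ ?_ d rfl ((le_self_add.trans hd).trans hc) x
    have h1 : ∑ i', (d + Pi.single i 1 : Fin n → ℕ) i' ≤ ∑ i', c i' :=
      Finset.sum_le_sum fun i' _ => hd i'
    simp only [Pi.add_apply, Finset.sum_add_distrib, Finset.sum_pi_single', Finset.mem_univ,
      if_true] at h1
    omega
  have hdecomp : ∀ (c : Fin n → ℕ) (i : Fin n), c i ≠ 0 → ∃ d : Fin n → ℕ, c = d + Pi.single i 1 := by
    intro c i hi
    refine ⟨c - Pi.single i 1, (tsub_add_cancel_of_le ?_).symm⟩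
    intro i'
    by_cases h : i' = i
    · subst h; simpa using Nat.one_le_iff_ne_zero.2 hi
    · simp [h]
  by_cases h0 : c = 0
  · simp [h0, hG]
  obtain ⟨i, hi⟩ : ∃ i, c i ≠ 0 := by
    by_contra! h
    exact h0 (funext h)
  obtain ⟨d, rfl⟩ := hdecomp c i hi
  have hdi : d i < k i := by simpa using hc i
  obtain ⟨a, ha⟩ := hjump d (le_self_add.trans hc) i hdi
  suffices ∀ x, a * φ i (d i) x = A i (d i) * φ i (d i) x by
    rw [ha, hGs, ih' d i le_rfl, this]; ring
  -- Off the axis, some other index can be lowered, and the increment `a` is compared with that on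
  -- the opposite side of a square; on the axis it is `A` by construction.
  by_cases hother : ∃ i', i' ≠ i ∧ d i' ≠ 0
  · obtain ⟨i', hii, hi'⟩ := hother
    obtain ⟨e, rfl⟩ := hdecomp d i' hi'
    have hei : (e + Pi.single i' 1 : Fin n → ℕ) i = e i := by simp [Ne.symm hii]
    have hei' : (e + Pi.single i 1 : Fin n → ℕ) i' = e i' := by simp [hii]
    have hcomm : e + Pi.single i' 1 + Pi.single i 1 = e + Pi.single i 1 + Pi.single i' 1 :=
      add_right_comm _ _ _
    rw [hei] at ha hdi ⊢
    have he' : e i' < k i' := by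
      have := hc i'
      simpa [hii] using this
    obtain ⟨b, hb⟩ := hjump (e + Pi.single i 1)
      (le_self_add.trans (hcomm ▸ hc)) i' (by rwa [hei'])
    rw [hei'] at hb
    -- The two paths round the square from `e` have the same total increment. At a point where `φ i`
    -- vanishes and `φ i'` does not, this forces `b` to be `A i' (e i')`, and then the `φ i` terms
    -- agree.
    have hsum : ∀ x, a * φ i (e i) x + A i' (e i') * φ i' (e i') x =
        A i (e i) * φ i (e i) x + b * φ i' (e i') x := by
      intro x
      have e1 := ha x
      have e2 := hb x
      rw [← hcomm] at e2
      rw [ih' _ i le_rfl, hGs] at e1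
      rw [ih' (e + Pi.single i 1) i' hcomm.ge, hGs] at e2
      linarith
    obtain ⟨y, hy0, hy1⟩ := hsep i i' (e i) (e i') (Ne.symm hii) hdi he'
    have hab : A i' (e i') = b := by
      have := hsum y
      rw [hy0, mul_zero, mul_zero, zero_add, zero_add] at this
      exact mul_right_cancel₀ hy1 this
    intro x
    have := hsum x
    rw [hab] at this
    linarith
  · push Not at hother
    have hd : d = Pi.single i (d i) := by
      ext i'
      by_cases h : i' = i
      · subst h; simp
      · simp [h, hother i' h]
    intro x
    have e1 := hA i (d i) hdi x
    rw [← hd, ha x] at e1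
    linarith

/-- In layer `c i` exactly the equations with index below `c i` are positive, so the sum of jumps
crossed from cell `0` is the sum of truncated powers; `m ≠ 0` makes the others vanish. -/
theorem FullCells.exists_truncatedPower_repr (hne : FullCells l) {m : ℕ} (hm : m ≠ 0)
    {S : EuclideanSpace ℝ (Fin n) → ℝ} (hS : S ∈ splineSpace {h | ∃ i j, h = l i j} m) :
    ∃ (p : MvPolynomial (Fin n) ℝ) (A : (i : Fin n) → Fin (k i) → ℝ), p.totalDegree ≤ m ∧
      ∀ c ≤ k, ∀ x ∈ cell l c,
        S x = polyEval p x + ∑ i, ∑ j, A i j * max ((l i j).eval x) 0 ^ m := by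
  classical
  obtain ⟨p, hp1, hp2⟩ := hS
  set φ : Fin n → ℕ → EuclideanSpace ℝ (Fin n) → ℝ := fun i j x =>
    if h : j < k i then (l i ⟨j, h⟩).eval x ^ m else 0 with hφ
  obtain ⟨A, hA⟩ := exists_eq_add_sum_of_increments (k := k)
    (fun c x => polyEval (p (closure (cell l c))) x) φ
    (by
      intro c hc i hi
      simp only [hφ, hi, dif_pos]
      exact hne.exists_jump (fun R hR => (hp1 R hR).1) hp2 hc hi)
    -- A point of a face of `l i j` lies on no hyperplane of another chain.
    (by
      intro i i' j j' hii hj hj'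
      obtain ⟨z, r, -, hz, hz', -⟩ := hne.exists_face (c := Pi.single i j)
        (fun i'' => by
          by_cases h : i'' = i
          · subst h; simpa using hj.le
          · simp [h]) (i := i) (by simpa using hj)
      simp only [Pi.single_eq_same] at hz
      refine ⟨z, ?_, ?_⟩
      · simp only [hφ, hj, dif_pos, hz]
        exact zero_pow hm
      · simp only [hφ, hj', dif_pos]
        exact pow_ne_zero _ (hz' i' _ hii.symm))
  refine ⟨p (closure (cell l 0)), fun i j => A i j,
    (hp1 _ (closure_cell_mem_regions l (hne 0 fun _ => Nat.zero_le _))).1, fun c hc x hx => ?_⟩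
  rw [(hp1 _ (closure_cell_mem_regions l (hne c hc))).2 x (subset_closure hx), hA c hc x]
  congr 1
  refine Finset.sum_congr rfl fun i _ => ?_
  have h1 : ∑ j : Fin (k i), A i j * max ((l i j).eval x) 0 ^ m =
      ∑ j ∈ Finset.range (k i), if j < c i then A i j * φ i j x else 0 := by
    rw [Finset.sum_range]
    refine Finset.sum_congr rfl fun j _ => ?_
    split_ifs with h
    · rw [max_eq_left ((hx.2 i j).1 h).le]
      simp [hφ]
    · rw [max_eq_right ((hx.2 i j).2 (not_lt.1 h)).le, zero_pow hm, mul_zero]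
  rw [h1, ← Finset.sum_filter]
  refine Finset.sum_congr ?_ fun _ _ => rfl
  ext j
  simp only [Finset.mem_range, Finset.mem_filter]
  exact ⟨fun h => ⟨h.trans_le (hc i), h⟩, fun h => h.2⟩

theorem OrientedHyperplane.volume_carrier (h : OrientedHyperplane n) :
    volume h.carrier = 0 := by
  set s : AffineSubspace ℝ (EuclideanSpace ℝ (Fin n)) :=
    { carrier := h.carrier
      smul_vsub_vadd_mem' := by
        intro t x y z hx hy hz
        change h.eval _ = 0
        have hx : h.eval x = 0 := hx
        have hy : h.eval y = 0 := hy
        have hz : h.eval z = 0 := hz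
        rw [vsub_eq_sub, vadd_eq_add, add_comm, h.eval_add, inner_smul_right, hz]
        have := h.eval_add y (x - y)
        rw [add_sub_cancel, hx, hy] at this
        rw [← zero_add (inner ℝ h.normal (x - y)), ← this]; simp } with hs
  refine Measure.addHaar_affineSubspace volume s fun htop => ?_
  have hall : ∀ x, h.eval x = 0 := fun x => by
    have : x ∈ s := htop ▸ AffineSubspace.mem_top ℝ _ x
    exact this
  have := h.eval_add 0 h.normal
  rw [hall, hall, zero_add] at this
  exact h.normal_ne (inner_self_eq_zero.1 this.symm)

theorem ae_exists_mem_cell (hl : ∀ i j j', j < j' → (l i j).Precedes (l i j')) :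
    ∀ᵐ x ∂(volume.restrict (unitCube n)), ∃ c : Fin n → ℕ, c ≤ k ∧ x ∈ cell l c := by
  have hU := (isCompact_unitCube n).measurableSet
  rw [ae_restrict_iff' hU]
  have h1 : ∀ᵐ x ∂(volume : Measure (EuclideanSpace ℝ (Fin n))), x ∉ frontier (unitCube n) :=
    measure_eq_zero_iff_ae_notMem.1 ((convex_unitCube n).addHaar_frontier volume)
  have h2 : ∀ᵐ x ∂(volume : Measure (EuclideanSpace ℝ (Fin n))),
      ∀ i j, x ∉ (l i j).carrier :=
    ae_all_iff.2 fun i => ae_all_iff.2 fun j =>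
      measure_eq_zero_iff_ae_notMem.1 (l i j).volume_carrier
  filter_upwards [h1, h2] with x hx1 hx2 hxU
  refine exists_mem_cell l hl ⟨?_, ?_⟩
  · by_contra h
    exact hx1 ⟨subset_closure hxU, h⟩
  · simp only [Set.mem_iUnion, not_exists]
    rintro _ ⟨i, j, rfl⟩
    exact hx2 i j

end Faces

/-- A closed subspace is complete, so the integral can be taken inside it and mapped by the
inclusion. -/
theorem Submodule.integral_mem_of_hasCompactSupport {F : Type*} [NormedAddCommGroup F]
    [NormedSpace ℝ F] [CompleteSpace F] {V : Submodule ℝ F} (hV : IsClosed (V : Set F))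
    {g : ℝ → F} (hg : Continuous g) (hgc : HasCompactSupport g) (h : ∀ y, g y ∈ V) :
    ∫ y, g y ∈ V := by
  have : CompleteSpace V := hV.completeSpace_coe
  set g' : ℝ → V := fun y => ⟨g y, h y⟩ with hg'
  have hcont : Continuous g' := hg.subtype_mk h
  have hsupp : HasCompactSupport g' := by
    refine hgc.mono fun y hy => ?_
    intro h0
    exact hy (Subtype.ext h0)
  have hint : Integrable g' := hcont.integrable_of_hasCompactSupport hsupp
  have := V.subtypeL.integral_comp_comm hint
  have h2 : ∫ y, g y = V.subtypeL (∫ y, g' y) := this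
  rw [h2]
  exact (∫ y, g' y).2

/-! ### Recognising polynomials on a half-line by mollification. -/

section Polynomials

/-- `Q` is the Taylor polynomial at `a`; the remainder is bounded by zero. -/
theorem exists_polynomial_of_iteratedDeriv_eq_zero {g : ℝ → ℝ} (k : ℕ) (hg : ContDiff ℝ k g)
    {a : ℝ} (h : ∀ y, a ≤ y → iteratedDeriv k g y = 0) :
    ∃ Q : Polynomial ℝ, Q.degree < k ∧ ∀ y, a ≤ y → g y = Q.eval y := by
  rcases k with _ | k
  · exact ⟨0, by simp, fun y hy => by simpa using h y hy⟩
  · refine ⟨∑ i ∈ Finset.range (k + 1),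
      Polynomial.C ((i.factorial : ℝ)⁻¹ * iteratedDeriv i g a) *
        (Polynomial.X - Polynomial.C a) ^ i, ?_, fun y hy => ?_⟩
    · refine (Polynomial.degree_sum_le _ _).trans_lt ?_
      rw [Finset.sup_lt_iff (WithBot.bot_lt_coe _)]
      intro i hi
      rw [← Polynomial.smul_eq_C_mul]
      refine (Polynomial.degree_smul_le _ _).trans_lt ?_
      rw [Polynomial.degree_pow, Polynomial.degree_X_sub_C, nsmul_eq_mul, mul_one]
      exact_mod_cast Finset.mem_range.1 hi
    · rcases hy.eq_or_lt with rfl | hlt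
      · rw [Polynomial.eval_finsetSum, Finset.sum_range_succ']
        simp
      · have hu : UniqueDiffOn ℝ (Set.Icc a y) := uniqueDiffOn_Icc hlt
        have hcd : ∀ i ≤ k + 1, ∀ x ∈ Set.Icc a y,
            iteratedDerivWithin i g (Set.Icc a y) x = iteratedDeriv i g x := fun i hi x hx =>
          iteratedDerivWithin_eq_iteratedDeriv hu
            ((hg.of_le (by exact_mod_cast hi)).contDiffAt) hx
        have hb := taylor_mean_remainder_bound (C := 0) (n := k) hlt.le
          (by exact_mod_cast hg.contDiffOn) (Set.right_mem_Icc.2 hlt.le) (by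
            intro x hx
            rw [hcd _ le_rfl x hx, h x hx.1, norm_zero])
        rw [zero_mul, zero_div, norm_le_zero_iff, sub_eq_zero, taylor_within_apply] at hb
        rw [hb, Polynomial.eval_finsetSum]
        refine Finset.sum_congr rfl fun i hi => ?_
        rw [hcd i (Finset.mem_range.1 hi).le a (Set.left_mem_Icc.2 hlt.le)]
        simp
        ring

/-- The convolution of `f` with a normalised bump function. -/
def mollify (φ : ContDiffBump (0 : ℝ)) (f : ℝ → ℝ) : ℝ → ℝ :=
  convolution (φ.normed volume) f (ContinuousLinearMap.lsmul ℝ ℝ) volume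

theorem mollify_apply (φ : ContDiffBump (0 : ℝ)) (f : ℝ → ℝ) (t : ℝ) :
    mollify φ f t = ∫ y, φ.normed volume y • f (t - y) := rfl

theorem contDiff_mollify (φ : ContDiffBump (0 : ℝ)) {f : ℝ → ℝ} (hf : Continuous f) (k : ℕ) :
    ContDiff ℝ k (mollify φ f) :=
  φ.hasCompactSupport_normed.contDiff_convolution_left (n := k) _ φ.contDiff_normed
    hf.locallyIntegrable

/-- Each mollification is a polynomial of degree below `k`, hence is interpolated from its values at
`1, …, k`. The interpolation formula passes to the pointwise limit as the bump shrinks. -/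
theorem exists_polynomial_of_mollify {f : ℝ → ℝ} (hf : Continuous f) (k : ℕ)
    (h : ∀ φ : ContDiffBump (0 : ℝ), ∀ b, φ.rOut < b → iteratedDeriv k (mollify φ f) b = 0) :
    ∃ P : Polynomial ℝ, P.degree < k ∧ ∀ t, 0 < t → f t = P.eval t := by
  set v : ℕ → ℝ := fun i => i + 1 with hv
  have hinj : Set.InjOn v (Finset.range k : Finset ℕ) := by
    intro i _ j _ hij
    simpa [hv] using hij
  refine ⟨Lagrange.interpolate (Finset.range k) v fun i => f (v i), ?_, fun t ht => ?_⟩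
  · simpa using Lagrange.degree_interpolate_lt (s := Finset.range k) (fun i => f (v i)) hinj
  · have hpos : ∀ j : ℕ, 0 < (1 : ℝ) / ((j : ℝ) + 1) := fun j => by positivity
    set φ : ℕ → ContDiffBump (0 : ℝ) := fun j =>
      ⟨1 / ((j : ℝ) + 1) / 2, 1 / ((j : ℝ) + 1), half_pos (hpos j), half_lt_self (hpos j)⟩ with hφ
    have hr : Tendsto (fun j => (φ j).rOut) atTop (𝓝 0) := tendsto_one_div_add_atTop_nhds_zero_nat
    have hlim : ∀ s, Tendsto (fun j => mollify (φ j) f s) atTop (𝓝 (f s)) := fun s =>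
      ContDiffBump.convolution_tendsto_right_of_continuous hr hf s
    -- Beyond `a` lie both `t` and all the nodes, so one polynomial serves for all of them.
    set a := min t 1 with ha
    have ha0 : 0 < a := lt_min ht one_pos
    have hev : ∀ᶠ j in atTop, mollify (φ j) f t =
        (Lagrange.interpolate (Finset.range k) v fun i => mollify (φ j) f (v i)).eval t := by
      filter_upwards [hr.eventually_lt_const ha0] with j hj
      obtain ⟨Q, hQ, hQe⟩ := exists_polynomial_of_iteratedDeriv_eq_zero k
        (contDiff_mollify (φ j) hf k) (a := a) fun y hy => h (φ j) y (hj.trans_le hy)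
      rw [hQe t (min_le_left _ _)]
      congr 1
      refine Lagrange.eq_interpolate_of_eval_eq _ hinj (by simpa using hQ) fun i _ => ?_
      refine (hQe _ ((min_le_right _ _).trans ?_)).symm
      simp [hv]
    refine tendsto_nhds_unique (hlim t) (Tendsto.congr' (EventuallyEq.symm hev) ?_)
    simp only [Lagrange.interpolate_apply, Polynomial.eval_finsetSum, Polynomial.eval_mul,
      Polynomial.eval_C]
    exact tendsto_finsetSum _ fun i _ => (hlim (v i)).mul_const _

end Polynomials

/-! ### Uniform approximation by global units. -/

section Ridge

variable {n : ℕ}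

instance compactSpace_unitCube : CompactSpace (unitCube n) :=
  isCompact_iff_compactSpace.1 (isCompact_unitCube n)

/-- The ridge function `x ↦ f (w · x + b)` on the cube. -/
def ridge (f : C(ℝ, ℝ)) (w : EuclideanSpace ℝ (Fin n)) (b : ℝ) : C(unitCube n, ℝ) :=
  ⟨fun x => f (inner ℝ w (x : EuclideanSpace ℝ (Fin n)) + b), by fun_prop⟩

@[simp]
theorem ridge_apply (f : C(ℝ, ℝ)) (w : EuclideanSpace ℝ (Fin n)) (b : ℝ) (x : unitCube n) :
    ridge f w b x = f (inner ℝ w (x : EuclideanSpace ℝ (Fin n)) + b) := rfl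

/-- The `i`-th coordinate function on the cube. -/
def coordinate (i : Fin n) : C(unitCube n, ℝ) :=
  ⟨fun x => (x : EuclideanSpace ℝ (Fin n)) i, by fun_prop⟩

@[simp]
theorem coordinate_apply (i : Fin n) (x : unitCube n) :
    coordinate i x = (x : EuclideanSpace ℝ (Fin n)) i := rfl

theorem continuous_ridge (f : C(ℝ, ℝ)) {Y : Type*} [TopologicalSpace Y]
    {w : Y → EuclideanSpace ℝ (Fin n)} {b : Y → ℝ} (hw : Continuous w) (hb : Continuous b) :
    Continuous fun y => ridge f (w y) (b y) := by
  refine ContinuousMap.continuous_of_continuous_uncurry _ ?_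
  change Continuous fun p : Y × unitCube n => f (inner ℝ (w p.1) (p.2 : EuclideanSpace ℝ _) + b p.1)
  fun_prop

/-- The uniform closure of the span of the units with universal global hyperplanes. -/
def globalClosure (n : ℕ) (f : C(ℝ, ℝ)) : Submodule ℝ C(unitCube n, ℝ) :=
  (Submodule.span ℝ (Set.range fun h : {h : OrientedHyperplane n // h.IsUniversalGlobal} =>
    ridge f h.1.normal h.1.bias)).topologicalClosure

theorem isClosed_globalClosure (f : C(ℝ, ℝ)) :
    IsClosed (globalClosure n f : Set C(unitCube n, ℝ)) :=
  Submodule.isClosed_topologicalClosure _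

theorem ridge_mem_globalClosure (hn : n ≠ 0) (f : C(ℝ, ℝ)) {w : EuclideanSpace ℝ (Fin n)} {b : ℝ}
    (h : ∀ x ∈ unitCube n, 0 ≤ inner ℝ w x + b) : ridge f w b ∈ globalClosure n f := by
  have key : ∀ w : EuclideanSpace ℝ (Fin n), w ≠ 0 →
      (∀ x ∈ unitCube n, 0 ≤ inner ℝ w x + b) → ridge f w b ∈ globalClosure n f := by
    intro w hw h
    exact Submodule.le_topologicalClosure _
      (Submodule.subset_span ⟨⟨⟨w, b, hw⟩, fun x hx => h x hx⟩, rfl⟩)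
  by_cases hw : w = 0
  · subst hw
    set i : Fin n := ⟨0, Nat.pos_of_ne_zero hn⟩
    set e : EuclideanSpace ℝ (Fin n) := EuclideanSpace.single i 1 with he
    -- A constant is not itself a unit, but it is a limit of units with weights `s • e`, which are
    -- global for `s > 0` because coordinates on the cube are nonnegative.
    have hlim : Tendsto (fun s : ℝ => ridge f (s • e) b) (𝓝[>] 0) (𝓝 (ridge f 0 b)) := by
      have : Continuous fun s : ℝ => ridge f (s • e) b :=
        continuous_ridge f (by fun_prop) (by fun_prop)
      simpa using (this.tendsto 0).mono_left nhdsWithin_le_nhds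
    refine (isClosed_globalClosure f).mem_of_tendsto hlim ?_
    filter_upwards [self_mem_nhdsWithin] with s hs
    have hs : 0 < s := hs
    refine key _ (smul_ne_zero hs.ne' (by simp [he])) fun x hx => ?_
    have h1 := h x hx
    rw [inner_zero_left] at h1
    have h2 : (inner ℝ e x : ℝ) = x i := by simp [he, EuclideanSpace.inner_single_left]
    rw [real_inner_smul_left, h2]
    have := mul_nonneg hs.le (hx i).1
    linarith
  · exact key w hw h

/-- The mollified ridge is an integral of ridges of `f` with biases shifted by less than `φ.rOut`;
the margin in the hypothesis keeps all of them global. -/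
theorem ridge_mollify_mem (hn : n ≠ 0) (f g : C(ℝ, ℝ)) (φ : ContDiffBump (0 : ℝ))
    (hg : ∀ t, g t = mollify φ f t) {w : EuclideanSpace ℝ (Fin n)} {b : ℝ}
    (h : ∀ x ∈ unitCube n, φ.rOut < inner ℝ w x + b) : ridge g w b ∈ globalClosure n f := by
  set F : ℝ → C(unitCube n, ℝ) := fun y => φ.normed volume y • ridge f w (b - y) with hF
  have hcont : Continuous F :=
    φ.continuous_normed.smul (continuous_ridge f continuous_const (by fun_prop))
  have hsupp : HasCompactSupport F := φ.hasCompactSupport_normed.smul_right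
  have hmem : ∀ y, F y ∈ globalClosure n f := by
    intro y
    by_cases hy : φ.normed volume y = 0
    · simp [hF, hy]
    · have : y ∈ Function.support (φ.normed volume) := hy
      rw [φ.support_normed_eq, mem_ball_zero_iff, Real.norm_eq_abs] at this
      refine Submodule.smul_mem _ _ (ridge_mem_globalClosure hn f fun x hx => ?_)
      have h1 := h x hx
      have h2 := (abs_lt.1 this).2
      linarith
  have hint : ridge g w b = ∫ y, F y := by
    ext x
    have hi : Integrable F := hcont.integrable_of_hasCompactSupport hsupp
    have := (ContinuousMap.evalCLM ℝ x).integral_comp_comm hi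
    change _ = ContinuousMap.evalCLM ℝ x (∫ y, F y)
    rw [← this, ridge_apply, hg, mollify_apply]
    refine integral_congr_ae (Eventually.of_forall fun y => ?_)
    simp [hF, add_sub_assoc]
  rw [hint]
  exact Submodule.integral_mem_of_hasCompactSupport (isClosed_globalClosure f) hcont hsupp hmem

/-- The derivative is taken in the uniform norm. Writing the ridge as an integral with values in
`C(unitCube n, ℝ)` replaces uniform estimates by the fundamental theorem of calculus. -/
theorem hasDerivAt_ridge {g g' : C(ℝ, ℝ)} (hg : ∀ t, HasDerivAt g (g' t) t)
    (w : EuclideanSpace ℝ (Fin n)) (b : ℝ) (i : Fin n) :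
    HasDerivAt (fun s : ℝ => ridge g (w + s • EuclideanSpace.single i 1) b)
      (coordinate i * ridge g' w b) 0 := by
  set G : ℝ → C(unitCube n, ℝ) := fun s =>
    coordinate i * ridge g' (w + s • EuclideanSpace.single i 1) b with hG
  have hGc : Continuous G :=
    continuous_const.mul (continuous_ridge g' (by fun_prop) continuous_const)
  have hFTC : (fun s : ℝ => ridge g (w + s • EuclideanSpace.single i 1) b) =
      fun s => ridge g w b + ∫ τ in (0 : ℝ)..s, G τ := by
    ext s x
    have hi : IntervalIntegrable G volume 0 s := hGc.intervalIntegrable _ _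
    have h1 := (ContinuousMap.evalCLM ℝ x).intervalIntegral_comp_comm hi
    change _ = ridge g w b x + ContinuousMap.evalCLM ℝ x (∫ τ in (0 : ℝ)..s, G τ)
    rw [← h1]
    have hlin : ∀ τ : ℝ, inner ℝ (w + τ • EuclideanSpace.single i (1 : ℝ))
        (x : EuclideanSpace ℝ (Fin n)) + b =
        inner ℝ w (x : EuclideanSpace ℝ (Fin n)) + τ * (x : EuclideanSpace ℝ (Fin n)) i + b := by
      intro τ
      rw [inner_add_left, real_inner_smul_left, EuclideanSpace.inner_single_left]
      simp
    have h2 : ∀ τ : ℝ, HasDerivAt (fun τ : ℝ =>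
        g (inner ℝ w (x : EuclideanSpace ℝ (Fin n)) + τ * (x : EuclideanSpace ℝ (Fin n)) i + b))
        (ContinuousMap.evalCLM ℝ x (G τ)) τ := by
      intro τ
      have h3 : HasDerivAt (fun τ : ℝ => inner ℝ w (x : EuclideanSpace ℝ (Fin n)) +
          τ * (x : EuclideanSpace ℝ (Fin n)) i + b) ((x : EuclideanSpace ℝ (Fin n)) i) τ := by
        simpa using (((hasDerivAt_id τ).mul_const ((x : EuclideanSpace ℝ (Fin n)) i)).const_add
          (inner ℝ w (x : EuclideanSpace ℝ (Fin n)))).add_const b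
      have h4 := (hg _).comp τ h3
      refine h4.congr_deriv ?_
      change _ = (coordinate i x) * ridge g' _ _ x
      rw [ridge_apply, hlin, coordinate_apply, mul_comm]
    rw [intervalIntegral.integral_eq_sub_of_hasDerivAt (fun τ _ => h2 τ)
      (((ContinuousMap.evalCLM ℝ x).continuous.comp hGc).intervalIntegrable _ _)]
    simp only [ridge_apply, hlin]
    simp
  rw [hFTC]
  have := (intervalIntegral.integral_hasDerivAt_right (hGc.intervalIntegrable 0 0)
    hGc.stronglyMeasurable.stronglyMeasurableAtFilter hGc.continuousAt).const_add (ridge g w b)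
  simpa [hG] using this

/-- The difference quotients in `w` stay in `V`, since by compactness of the cube the strict margin
`δ` survives small changes of `w`. -/
theorem mul_coordinate_mul_ridge_mem {V : Submodule ℝ C(unitCube n, ℝ)}
    (hV : IsClosed (V : Set C(unitCube n, ℝ))) {g g' : C(ℝ, ℝ)}
    (hg : ∀ t, HasDerivAt g (g' t) t) (q : C(unitCube n, ℝ)) {δ : ℝ}
    (h : ∀ w b, (∀ x ∈ unitCube n, δ < inner ℝ w x + b) → q * ridge g w b ∈ V)
    (i : Fin n) (w : EuclideanSpace ℝ (Fin n)) (b : ℝ)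
    (hwb : ∀ x ∈ unitCube n, δ < inner ℝ w x + b) :
    q * coordinate i * ridge g' w b ∈ V := by
  have hd : HasDerivAt (fun s : ℝ => q * ridge g (w + s • EuclideanSpace.single i 1) b)
      (q * (coordinate i * ridge g' w b)) 0 := (hasDerivAt_ridge hg w b i).const_mul q
  rw [mul_assoc]
  refine hV.mem_of_tendsto (hasDerivAt_iff_tendsto_slope.1 hd) ?_
  have hev : ∀ᶠ s : ℝ in 𝓝 0, ∀ x ∈ unitCube n,
      δ < inner ℝ (w + s • EuclideanSpace.single i 1) x + b := by
    refine (isCompact_unitCube n).eventually_forall_of_forall_eventually fun x hx => ?_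
    have hc : Continuous fun z : ℝ × EuclideanSpace ℝ (Fin n) =>
        (inner ℝ (w + z.1 • EuclideanSpace.single i 1) z.2 : ℝ) + b := by fun_prop
    exact hc.continuousAt.eventually_const_lt (by simpa using hwb x hx)
  filter_upwards [hev.filter_mono nhdsWithin_le_nhds] with s hs
  rw [slope_def_module]
  refine V.smul_mem _ (V.sub_mem (h _ _ hs) (h _ _ ?_))
  simpa using hwb

/-- The restriction of polynomials to the cube. -/
def restrictPolynomial (n : ℕ) : MvPolynomial (Fin n) ℝ →ₐ[ℝ] C(unitCube n, ℝ) :=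
  MvPolynomial.aeval coordinate

theorem restrictPolynomial_apply (p : MvPolynomial (Fin n) ℝ) (x : unitCube n) :
    restrictPolynomial n p x = polyEval p x := by
  have h : ∀ p, (ContinuousMap.evalAlgHom ℝ ℝ x) (restrictPolynomial n p) =
      MvPolynomial.aeval (fun i => (x : EuclideanSpace ℝ (Fin n)) i) p := by
    intro p
    rw [restrictPolynomial, ← AlgHom.comp_apply, MvPolynomial.comp_aeval]
    rfl
  exact h p

theorem monomial_mul_ridge_mem {V : Submodule ℝ C(unitCube n, ℝ)}
    (hV : IsClosed (V : Set C(unitCube n, ℝ))) {g : ℝ → ℝ} (hg : ∀ k : ℕ, ContDiff ℝ k g) {δ : ℝ}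
    (h : ∀ w b, (∀ x ∈ unitCube n, δ < inner ℝ w x + b) →
      ridge ⟨g, (hg 0).continuous⟩ w b ∈ V) (N : ℕ) :
    ∀ v : Fin n →₀ ℕ, v.degree = N → ∀ w b, (∀ x ∈ unitCube n, δ < inner ℝ w x + b) →
      restrictPolynomial n (MvPolynomial.monomial v 1) *
        ridge ⟨iteratedDeriv N g, (hg N).continuous_iteratedDeriv' N⟩ w b ∈ V := by
  induction N with
  | zero =>
    intro v hv w b hwb
    rw [Finsupp.degree_eq_zero_iff] at hv
    have h1 : MvPolynomial.monomial v (1 : ℝ) = 1 := by rw [hv]; rfl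
    rw [h1, map_one, one_mul]
    simpa using h w b hwb
  | succ N ih =>
    intro v hv w b hwb
    obtain ⟨i, hi⟩ : ∃ i, v i ≠ 0 := by
      by_contra! h0
      have : v = 0 := Finsupp.ext h0
      rw [this] at hv
      simp at hv
    have hsplit : v = (v - Finsupp.single i 1) + Finsupp.single i 1 :=
      (tsub_add_cancel_of_le (Finsupp.single_le_iff.2 (Nat.one_le_iff_ne_zero.2 hi))).symm
    set u := v - Finsupp.single i 1
    have hu : u.degree = N := by
      rw [hsplit, map_add, Finsupp.degree_single] at hv
      omega
    have hmon : MvPolynomial.monomial v (1 : ℝ) =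
        MvPolynomial.monomial u 1 * MvPolynomial.X i := by
      rw [hsplit, MvPolynomial.X, MvPolynomial.monomial_mul, one_mul]
    have hX : restrictPolynomial n (MvPolynomial.X i) = coordinate i := by
      simp [restrictPolynomial]
    rw [hmon, map_mul, hX]
    refine mul_coordinate_mul_ridge_mem hV
      (g := ⟨iteratedDeriv N g, (hg N).continuous_iteratedDeriv' N⟩) ?_ _ (ih u hu) i w b hwb
    intro t
    have hd : Differentiable ℝ (iteratedDeriv N g) :=
      (hg (N + 1)).differentiable_iteratedDeriv N (by exact_mod_cast Nat.lt_succ_self N)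
    simpa [iteratedDeriv_succ] using (hd t).hasDerivAt

/-- Differentiating the mollified ridge at `w = 0` gives the monomial times the constant
`iteratedDeriv v.degree (mollify φ f) b`, which is nonzero for some `φ` and `b` unless `f` is a
polynomial of lower degree on the half-line. -/
theorem restrictPolynomial_monomial_mem (hn : n ≠ 0) (f : C(ℝ, ℝ)) (v : Fin n →₀ ℕ)
    (hf : ¬ ∃ P : Polynomial ℝ, P.degree < (v.degree : ℕ) ∧ ∀ t, 0 < t → f t = P.eval t) :
    restrictPolynomial n (MvPolynomial.monomial v 1) ∈ globalClosure n f := by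
  obtain ⟨φ, b, hb, hne⟩ : ∃ φ : ContDiffBump (0 : ℝ), ∃ b, φ.rOut < b ∧
      iteratedDeriv v.degree (mollify φ f) b ≠ 0 := by
    by_contra! h
    exact hf (exists_polynomial_of_mollify f.continuous _ h)
  have h1 := monomial_mul_ridge_mem (isClosed_globalClosure f)
    (contDiff_mollify φ f.continuous) (δ := φ.rOut)
    (fun w b hwb => ridge_mollify_mem hn f _ φ (fun _ => rfl) hwb) _ v rfl 0 b
    (fun x _ => by simpa using hb)
  have h2 : restrictPolynomial n (MvPolynomial.monomial v 1) *
      ridge ⟨iteratedDeriv v.degree (mollify φ f), (contDiff_mollify φ f.continuous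
        v.degree).continuous_iteratedDeriv' _⟩ 0 b =
      iteratedDeriv v.degree (mollify φ f) b •
        restrictPolynomial n (MvPolynomial.monomial v 1) := by
    ext x
    simp [mul_comm]
  rw [h2] at h1
  exact (Submodule.smul_mem_iff _ hne).1 h1

theorem restrictPolynomial_mem (hn : n ≠ 0) (f : C(ℝ, ℝ)) (p : MvPolynomial (Fin n) ℝ)
    (hf : ¬ ∃ P : Polynomial ℝ, P.degree < p.totalDegree ∧ ∀ t, 0 < t → f t = P.eval t) :
    restrictPolynomial n p ∈ globalClosure n f := by
  rw [p.as_sum, map_sum]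
  refine Submodule.sum_mem _ fun v hv => ?_
  have h1 : MvPolynomial.monomial v (p.coeff v) = p.coeff v • MvPolynomial.monomial v (1 : ℝ) := by
    rw [MvPolynomial.smul_monomial, smul_eq_mul, mul_one]
  rw [h1, map_smul]
  refine Submodule.smul_mem _ _ (restrictPolynomial_monomial_mem hn f v ?_)
  rintro ⟨P, hP, hPf⟩
  refine hf ⟨P, hP.trans_le ?_, hPf⟩
  exact_mod_cast MvPolynomial.le_totalDegree hv

/-- If `f` is not a polynomial on `(0, ∞)`, the global units are uniformly dense. -/
theorem globalClosure_eq_top (hn : n ≠ 0) (f : C(ℝ, ℝ))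
    (hf : ¬ ∃ P : Polynomial ℝ, ∀ t, 0 < t → f t = P.eval t) : globalClosure n f = ⊤ := by
  have hsep : (restrictPolynomial n).range.SeparatesPoints := by
    intro x y hxy
    obtain ⟨i, hi⟩ : ∃ i, (x : EuclideanSpace ℝ (Fin n)) i ≠ (y : EuclideanSpace ℝ (Fin n)) i := by
      by_contra! h
      exact hxy (Subtype.ext (PiLp.ext h))
    refine ⟨coordinate i, ⟨coordinate i, ⟨MvPolynomial.X i, ?_⟩, rfl⟩, hi⟩
    simp [restrictPolynomial]
  have hden := ContinuousMap.subalgebra_topologicalClosure_eq_top_of_separatesPoints _ hsep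
  rw [eq_top_iff]
  intro g _
  have hg : g ∈ (restrictPolynomial n).range.topologicalClosure := hden ▸ trivial
  refine (isClosed_globalClosure f).closure_subset_iff.2 ?_ hg
  rintro _ ⟨p, rfl⟩
  exact restrictPolynomial_mem hn f p fun ⟨P, _, hP⟩ => hf ⟨P, hP⟩

end Ridge

/-! ### Approximating truncated powers by scaled sigmoidal functions. -/

namespace IsGeneralizedSigmoidal

variable {σ : ℝ → ℝ}

theorem nonneg_of_nonpos (hσ : IsGeneralizedSigmoidal σ) {t : ℝ} (ht : t ≤ 0) : 0 ≤ σ t := by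
  refine le_of_tendsto hσ.tendsto_atBot ?_
  filter_upwards [eventually_le_atBot t] with s hs
  exact hσ.monotoneOn (hs.trans ht) ht hs

theorem abs_le_of_nonpos (hσ : IsGeneralizedSigmoidal σ) {t : ℝ} (ht : t ≤ 0) : |σ t| ≤ σ 0 := by
  rw [abs_of_nonneg (hσ.nonneg_of_nonpos ht)]
  exact hσ.monotoneOn ht (Set.mem_Iic.2 le_rfl) ht

end IsGeneralizedSigmoidal

theorem Polynomial.exists_abs_eval_mul_sub_le (P : Polynomial ℝ) {M : ℝ} (hM : 0 ≤ M) :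
    ∃ C, 0 ≤ C ∧ ∀ ρ, 1 ≤ ρ → ∀ t, 0 ≤ t → t ≤ M →
      |P.eval (ρ * t) - P.leadingCoeff * ρ ^ P.natDegree * t ^ P.natDegree| * ρ ≤
        C * ρ ^ P.natDegree := by
  refine ⟨∑ k ∈ Finset.range P.natDegree, |P.coeff k| * M ^ k,
    Finset.sum_nonneg fun _ _ => by positivity, fun ρ hρ t ht htM => ?_⟩
  have hρ0 : 0 ≤ ρ := zero_le_one.trans hρ
  rw [Polynomial.eval_eq_sum_range, Finset.sum_range_succ, mul_pow, ← mul_assoc,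
    Polynomial.leadingCoeff, add_sub_cancel_right, Finset.sum_mul]
  refine (mul_le_mul_of_nonneg_right (Finset.abs_sum_le_sum_abs _ _) hρ0).trans ?_
  rw [Finset.sum_mul]
  refine Finset.sum_le_sum fun k hk => ?_
  rw [abs_mul, mul_pow, abs_of_nonneg (mul_nonneg (pow_nonneg hρ0 k) (pow_nonneg ht k))]
  have h1 : ρ ^ k * ρ ≤ ρ ^ P.natDegree := by
    rw [← pow_succ]
    exact pow_le_pow_right₀ hρ (Finset.mem_range.1 hk)
  have h2 : t ^ k ≤ M ^ k := pow_le_pow_left₀ ht htM k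
  calc |P.coeff k| * (ρ ^ k * t ^ k) * ρ = |P.coeff k| * (t ^ k * (ρ ^ k * ρ)) := by ring
    _ ≤ |P.coeff k| * (M ^ k * ρ ^ P.natDegree) := by gcongr
    _ = _ := by ring

theorem IsGeneralizedSigmoidal.exists_abs_sub_truncatedPower_le_of_ne {σ : ℝ → ℝ}
    (hσ : IsGeneralizedSigmoidal σ) {P : Polynomial ℝ} (hP : P.natDegree ≠ 0)
    (hσP : ∀ t, 0 < t → σ t = P.eval t) {a : ℝ} (ha : a ≠ 0) (M : ℝ) {δ : ℝ} (hδ : 0 < δ) :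
    ∃ lam ρ : ℝ, lam ≠ 0 ∧ 0 < ρ ∧ ∀ t, |t| ≤ M →
      |lam * σ (ρ * t) - a * max t 0 ^ P.natDegree| ≤ δ := by
  obtain ⟨C, hC0, hC⟩ := P.exists_abs_eval_mul_sub_le (abs_nonneg M)
  set m := P.natDegree with hm
  set α := P.leadingCoeff with hα
  have hα0 : α ≠ 0 := by
    rw [hα, Polynomial.leadingCoeff_ne_zero]
    rintro rfl
    simp [hm] at hP
  have hσ0 : 0 ≤ σ 0 := hσ.nonneg_of_nonpos le_rfl
  set K := |a| / |α| * (C + σ 0) with hK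
  have hK0 : 0 ≤ K := by positivity
  set ρ := max 1 (K / δ) with hρ
  have hρ1 : 1 ≤ ρ := le_max_left _ _
  have hρ0 : 0 < ρ := zero_lt_one.trans_le hρ1
  have hKρ : K ≤ δ * ρ := by
    have := (div_le_iff₀ hδ).1 (le_max_right 1 (K / δ))
    linarith
  have hρm : 0 < ρ ^ m := pow_pos hρ0 m
  have hρle : ρ ≤ ρ ^ m := le_self_pow₀ hρ1 hP
  refine ⟨a / (α * ρ ^ m), ρ, div_ne_zero ha (mul_ne_zero hα0 hρm.ne'), hρ0, fun t ht => ?_⟩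
  -- The error is of order `ρ ^ (m - 1)`: lower-order terms for `t > 0`, and the bound `σ 0` for `t
  -- ≤ 0`. After division by `α * ρ ^ m` it is at most `K / ρ`.
  suffices |σ (ρ * t) - α * ρ ^ m * max t 0 ^ m| * ρ ≤ (C + σ 0) * ρ ^ m by
    have h1 : a / (α * ρ ^ m) * σ (ρ * t) - a * max t 0 ^ m =
        a / (α * ρ ^ m) * (σ (ρ * t) - α * ρ ^ m * max t 0 ^ m) := by
      field_simp
    rw [h1, abs_mul, abs_div, abs_mul, abs_of_pos hρm]
    refine le_of_mul_le_mul_right ?_ hρ0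
    calc |a| / (|α| * ρ ^ m) * |σ (ρ * t) - α * ρ ^ m * max t 0 ^ m| * ρ
        = |a| / (|α| * ρ ^ m) * (|σ (ρ * t) - α * ρ ^ m * max t 0 ^ m| * ρ) := by ring
      _ ≤ |a| / (|α| * ρ ^ m) * ((C + σ 0) * ρ ^ m) := by gcongr
      _ = K := by rw [hK]; field_simp
      _ ≤ δ * ρ := hKρ
  rcases le_or_gt t 0 with h | h
  · rw [max_eq_right h, zero_pow hP, mul_zero, sub_zero]
    have := hσ.abs_le_of_nonpos (mul_nonpos_of_nonneg_of_nonpos hρ0.le h)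
    calc |σ (ρ * t)| * ρ ≤ σ 0 * ρ ^ m := by gcongr
      _ ≤ (C + σ 0) * ρ ^ m := by gcongr; linarith
  · rw [max_eq_left h.le, hσP _ (mul_pos hρ0 h)]
    refine (hC ρ hρ1 t h.le ((le_abs_self t).trans (ht.trans (le_abs_self M)))).trans ?_
    gcongr
    linarith

theorem IsGeneralizedSigmoidal.exists_abs_sub_truncatedPower_le {σ : ℝ → ℝ}
    (hσ : IsGeneralizedSigmoidal σ) {P : Polynomial ℝ} (hP : P.natDegree ≠ 0)
    (hσP : ∀ t, 0 < t → σ t = P.eval t) (a M : ℝ) {δ : ℝ} (hδ : 0 < δ) :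
    ∃ lam ρ : ℝ, lam ≠ 0 ∧ 0 < ρ ∧ ∀ t, |t| ≤ M →
      |lam * σ (ρ * t) - a * max t 0 ^ P.natDegree| ≤ δ := by
  by_cases ha : a = 0
  -- An output weight must be nonzero, so the zero function is approximated through the small
  -- nonzero coefficient `δ / 2 / B`.
  · set B := |M| ^ P.natDegree + 1 with hB
    have hB0 : 0 < B := by positivity
    obtain ⟨lam, ρ, h1, h2, h3⟩ := hσ.exists_abs_sub_truncatedPower_le_of_ne hP hσP
      (a := δ / 2 / B) (by positivity) M (half_pos hδ)
    refine ⟨lam, ρ, h1, h2, fun t ht => ?_⟩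
    have h4 := h3 t ht
    have h5 : max t 0 ^ P.natDegree ≤ B := by
      have : max t 0 ≤ |M| :=
        max_le ((le_abs_self t).trans (ht.trans (le_abs_self M))) (abs_nonneg M)
      have := pow_le_pow_left₀ (le_max_right t 0) this P.natDegree
      linarith
    have h6 : 0 ≤ max t 0 ^ P.natDegree := pow_nonneg (le_max_right _ _) _
    have h7 : δ / 2 / B * max t 0 ^ P.natDegree ≤ δ / 2 := by
      calc δ / 2 / B * max t 0 ^ P.natDegree ≤ δ / 2 / B * B := by gcongr
        _ = δ / 2 := by field_simp
    have h8 : 0 ≤ δ / 2 / B * max t 0 ^ P.natDegree := by positivity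
    rw [ha, zero_mul, sub_zero]
    rw [abs_le] at h4 ⊢
    constructor <;> linarith
  · exact hσ.exists_abs_sub_truncatedPower_le_of_ne hP hσP ha M hδ

theorem exists_abs_mul_le_of_continuous {f : ℝ → ℝ} (hf : Continuous f) (M : ℝ) {δ : ℝ}
    (hδ : 0 < δ) : ∃ lam : ℝ, 0 < lam ∧ ∀ t, |t| ≤ M → lam * |f t| ≤ δ := by
  obtain ⟨B, hB⟩ := (isCompact_Icc (a := -M) (b := M)).exists_bound_of_continuousOn hf.continuousOn
  refine ⟨δ / (|B| + 1), by positivity, fun t ht => ?_⟩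
  have h1 := hB t (abs_le.1 ht)
  rw [Real.norm_eq_abs] at h1
  have h2 : |f t| ≤ |B| + 1 := by linarith [le_abs_self B]
  calc δ / (|B| + 1) * |f t| ≤ δ / (|B| + 1) * (|B| + 1) := by gcongr
    _ = δ := by field_simp

theorem exists_approxWithin_of_ae_bound (n : ℕ) {ε : ℝ} (hε : 0 < ε) :
    ∃ η, 0 < η ∧ ∀ f g : EuclideanSpace ℝ (Fin n) → ℝ,
      (∀ᵐ x ∂volume.restrict (unitCube n), |f x - g x| ≤ η) → ApproxWithin f g ε := by
  set μ := (volume : Measure (EuclideanSpace ℝ (Fin n))).restrict (unitCube n) with hμ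
  have : IsFiniteMeasure μ := ⟨by
    rw [hμ, Measure.restrict_apply_univ]; exact (isCompact_unitCube n).measure_lt_top⟩
  set v := μ Set.univ ^ (2 : ENNReal).toReal⁻¹ with hv
  have hvt : v ≠ ⊤ := ENNReal.rpow_ne_top_of_nonneg (by simp) (measure_ne_top _ _)
  refine ⟨ε / (v.toReal + 1), by positivity, fun f g h => ?_⟩
  have h1 := eLpNorm_le_of_ae_bound (p := 2) (μ := μ) (f := fun x => f x - g x) h
  refine h1.trans_lt ?_
  rw [← hv, ← ENNReal.ofReal_toReal hvt, ← ENNReal.ofReal_mul ENNReal.toReal_nonneg,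
    ENNReal.ofReal_lt_ofReal_iff hε, ENNReal.toReal_ofReal ENNReal.toReal_nonneg]
  have : 0 ≤ v.toReal := ENNReal.toReal_nonneg
  rw [← mul_div_assoc, div_lt_iff₀ (by positivity)]
  nlinarith

/-! ### Assembling the network. -/

namespace OrientedHyperplane

variable {n : ℕ}

/-- The same hyperplane, with its equation multiplied by `ρ`. -/
def scale (h : OrientedHyperplane n) {ρ : ℝ} (hρ : 0 < ρ) : OrientedHyperplane n :=
  ⟨ρ • h.normal, ρ * h.bias, smul_ne_zero hρ.ne' h.normal_ne⟩

theorem eval_scale (h : OrientedHyperplane n) {ρ : ℝ} (hρ : 0 < ρ)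
    (x : EuclideanSpace ℝ (Fin n)) : (h.scale hρ).eval x = ρ * h.eval x := by
  simp only [scale, eval, real_inner_smul_left]; ring

theorem exists_abs_eval_le (h : OrientedHyperplane n) :
    ∃ M, ∀ x ∈ unitCube n, |h.eval x| ≤ M :=
  (isCompact_unitCube n).exists_bound_of_continuousOn h.continuous_eval.continuousOn

/-- The universal global hyperplane `x i + t = 0`, for `t ≥ 0`. -/
def shifted (i : Fin n) (t : ℝ) : OrientedHyperplane n :=
  ⟨EuclideanSpace.single i 1, t, by simp⟩

theorem eval_shifted (i : Fin n) (t : ℝ) (x : EuclideanSpace ℝ (Fin n)) :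
    (shifted i t).eval x = x i + t := by
  simp [shifted, eval, EuclideanSpace.inner_single_left]

theorem isUniversalGlobal_shifted (i : Fin n) {t : ℝ} (ht : 0 ≤ t) :
    (shifted i t).IsUniversalGlobal := by
  intro x hx
  change 0 ≤ (shifted i t).eval x
  rw [eval_shifted]
  exact add_nonneg (hx i).1 ht

theorem carrier_shifted_injective (i : Fin n) :
    Function.Injective fun t : ℝ => (shifted i t).carrier := by
  intro s t (hst : (shifted i s).carrier = (shifted i t).carrier)
  have h1 : EuclideanSpace.single i (-s) ∈ (shifted i s).carrier := by
    change (shifted i s).eval _ = 0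
    simp [eval_shifted]
  rw [hst] at h1
  have h2 : (shifted i t).eval _ = 0 := h1
  rw [eval_shifted] at h2
  simp at h2
  linarith

end OrientedHyperplane

/-- The network with units indexed by an arbitrary finite type. -/
def TwoLayerNetwork.ofFintype {n : ℕ} {ι : Type*} [Fintype ι] (plane : ι → OrientedHyperplane n)
    (out : ι → ℝ) (hout : ∀ i, out i ≠ 0) : TwoLayerNetwork n (Fintype.card ι) where
  plane i := plane ((Fintype.equivFin ι).symm i)
  out i := out ((Fintype.equivFin ι).symm i)
  out_ne _ := hout _

theorem TwoLayerNetwork.output_ofFintype {n : ℕ} {ι : Type*} [Fintype ι]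
    (plane : ι → OrientedHyperplane n) (out : ι → ℝ) (hout : ∀ i, out i ≠ 0) (σ : ℝ → ℝ)
    (x : EuclideanSpace ℝ (Fin n)) :
    (ofFintype plane out hout).output σ x = ∑ i, out i * σ ((plane i).eval x) :=
  Equiv.sum_comp (Fintype.equivFin ι).symm fun i => out i * σ ((plane i).eval x)

open Classical in
theorem TwoLayerNetwork.truncatedOutput_bias {n Θ : ℕ} (N : TwoLayerNetwork n Θ) (σ : ℝ → ℝ)
    (i : Fin Θ) (x : EuclideanSpace ℝ (Fin n)) :
    N.truncatedOutput σ i (N.plane i).bias x = N.output σ x -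
      if (N.plane i).eval x ≤ 0 then N.out i * σ ((N.plane i).eval x) else 0 := by
  rw [eq_sub_iff_add_eq]
  have h : (if (N.plane i).eval x ≤ 0 then N.out i * σ ((N.plane i).eval x) else 0) =
      ∑ j, if j = i then (if (N.plane j).eval x ≤ 0 then
        N.out j * σ ((N.plane j).eval x) else 0) else 0 := by
    simp
  rw [h, truncatedOutput, output, ← Finset.sum_add_distrib]
  refine Finset.sum_congr rfl fun j _ => ?_
  by_cases hj : j = i
  · subst hj
    by_cases hx : (N.plane j).eval x ≤ 0
    · have : inner ℝ (N.plane j).normal x + (N.plane j).bias ≤ 0 := hx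
      simp [hx, this]
    · have : ¬ inner ℝ (N.plane j).normal x + (N.plane j).bias ≤ 0 := hx
      simp [hx, this]
  · simp [hj]

/-- Potential parameters are at least the bias by definition, so once the bias itself is one of them
it is the infimum. -/
theorem TwoLayerNetwork.isZeroErrorHyperplane_of_scale {n Θ : ℕ} {N : TwoLayerNetwork n Θ}
    {σ : ℝ → ℝ} {f : EuclideanSpace ℝ (Fin n) → ℝ} {ε : ℝ} {i : Fin Θ}
    {h : OrientedHyperplane n} {ρ : ℝ} (hρ : 0 < ρ) (hp : N.plane i = h.scale hρ)
    (happ : ApproxWithin f (N.truncatedOutput σ i (N.plane i).bias) ε) :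
    N.IsZeroErrorHyperplane σ f ε i h := by
  refine ⟨ρ, hρ, by rw [hp]; rfl, IsLeast.isGLB ?_⟩
  have hb : (N.plane i).bias = ρ * h.bias := by rw [hp]; rfl
  refine ⟨⟨hb.le, ?_⟩, fun c hc => ?_⟩
  · rw [← hb]; exact happ
  · rw [← hb]; exact hc.1

section Realization

variable {n : ℕ} {ι : Type*} [Fintype ι] {l : ι → OrientedHyperplane n}

theorem exists_realizesFrom (hn : n ≠ 0) (hl : Function.Injective l) (m M : ℕ)
    (hM : (n + m).choose m ≤ M) (σ : C(ℝ, ℝ)) {S : EuclideanSpace ℝ (Fin n) → ℝ}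
    {T : C(unitCube n, ℝ)} (hT : T ∈ globalClosure n σ)
    {ψ : ι → EuclideanSpace ℝ (Fin n) → ℝ}
    (hψ0 : ∀ q x, (l q).eval x ≤ 0 → ψ q x = 0)
    (hψ : ∀ q, ∀ δ > 0, ∃ lam ρ : ℝ, lam ≠ 0 ∧ 0 < ρ ∧ ∀ x ∈ unitCube n,
      |lam * σ (ρ * (l q).eval x) - ψ q x| ≤ δ)
    (hS : ∀ᵐ x ∂volume.restrict (unitCube n), ∀ hx : x ∈ unitCube n,
      S x = T ⟨x, hx⟩ + ∑ q, ψ q x) {ε : ℝ} (hε : 0 < ε) :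
    ∃ (Θ : ℕ) (N : TwoLayerNetwork n Θ), N.RealizesFrom σ m (Set.range l) S ε := by
  classical
  obtain ⟨η, hη, happ⟩ := exists_approxWithin_of_ae_bound n hε
  -- One `δ` for each local unit, one for approximating `T`, one for the extra global units, and one
  -- for truncating a single unit.
  set δ := η / (Fintype.card ι + 3) with hδ
  have hδ0 : 0 < δ := by positivity
  choose lam ρ hlam hρ hloc using fun q => hψ q δ hδ0
  obtain ⟨G, hG, hGT⟩ := Metric.mem_closure_iff.1 hT δ hδ0
  obtain ⟨c, rfl⟩ := Finsupp.mem_span_range_iff_exists_finsupp.1 hG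
  set i₀ : Fin n := ⟨0, Nat.pos_of_ne_zero hn⟩
  -- The `M` extra units, with distinct parallel hyperplanes and negligible weight `τ`, guarantee
  -- the required number of global hyperplanes. Their arguments lie in `[0, M + 1]`.
  obtain ⟨τ, hτ, hτle⟩ := exists_abs_mul_le_of_continuous σ.continuous (M + 1)
    (δ := δ / (M + 1)) (by positivity)
  set plane : ι ⊕ (c.support ⊕ Fin M) → OrientedHyperplane n := Sum.elim
    (fun q => (l q).scale (hρ q))
    (Sum.elim (fun h => h.1.1) fun j => OrientedHyperplane.shifted i₀ j) with hplane
  set out : ι ⊕ (c.support ⊕ Fin M) → ℝ := Sum.elim lam (Sum.elim (fun h => c h.1) fun _ => τ)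
    with hout
  have hout0 : ∀ i, out i ≠ 0 := by
    rintro (q | h | j)
    · exact hlam q
    · exact Finsupp.mem_support_iff.1 h.2
    · exact hτ.ne'
  set N := TwoLayerNetwork.ofFintype plane out hout0 with hN
  set e := Fintype.equivFin (ι ⊕ (c.support ⊕ Fin M)) with he
  have hNplane : ∀ i, N.plane (e i) = plane i := fun i => by
    simp [hN, TwoLayerNetwork.ofFintype, he]
  have hNout : ∀ i, N.out (e i) = out i := fun i => by
    simp [hN, TwoLayerNetwork.ofFintype, he]
  have herr : ∀ᵐ x ∂volume.restrict (unitCube n), x ∈ unitCube n ∧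
      |S x - N.output σ x| ≤ (Fintype.card ι + 2) * δ := by
    filter_upwards [hS, ae_restrict_mem (isCompact_unitCube n).measurableSet] with x hx hxU
    refine ⟨hxU, ?_⟩
    rw [hx hxU, hN, TwoLayerNetwork.output_ofFintype, Fintype.sum_sum_type, Fintype.sum_sum_type]
    simp only [hplane, hout, Sum.elim_inl, Sum.elim_inr, OrientedHyperplane.eval_scale]
    have h1 : |∑ q, (lam q * σ (ρ q * (l q).eval x) - ψ q x)| ≤ Fintype.card ι * δ := by
      refine (Finset.abs_sum_le_sum_abs _ _).trans ?_
      refine (Finset.sum_le_sum fun q _ => hloc q x hxU).trans ?_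
      simp
    have h2 : |T ⟨x, hxU⟩ - ∑ h : c.support, c h.1 * σ (h.1.1.eval x)| ≤ δ := by
      have h3 := (ContinuousMap.dist_apply_le_dist (⟨x, hxU⟩ : unitCube n)).trans hGT.le
      rw [Real.dist_eq] at h3
      have h4 : (c.sum fun h a => a • ridge σ h.1.normal h.1.bias) ⟨x, hxU⟩ =
          ∑ h : c.support, c h.1 * σ (h.1.1.eval x) := by
        unfold Finsupp.sum
        rw [ContinuousMap.sum_apply]
        exact (Finset.sum_coe_sort c.support fun h => c h * σ (h.1.eval x)).symm
      rwa [h4] at h3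
    have h3 : |∑ j : Fin M, τ * σ ((OrientedHyperplane.shifted i₀ (j : ℝ)).eval x)| ≤ δ := by
      refine (Finset.abs_sum_le_sum_abs _ _).trans ?_
      have h4 : ∀ j ∈ (Finset.univ : Finset (Fin M)),
          |τ * σ ((OrientedHyperplane.shifted i₀ (j : ℝ)).eval x)| ≤ δ / (M + 1) := by
        intro j _
        rw [abs_mul, abs_of_pos hτ]
        refine hτle _ ?_
        rw [OrientedHyperplane.eval_shifted]
        have h5 := hxU i₀
        have h6 : ((j : ℕ) : ℝ) ≤ M := by exact_mod_cast j.2.le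
        have h7 : (0 : ℝ) ≤ (j : ℕ) := Nat.cast_nonneg _
        rw [abs_of_nonneg (add_nonneg h5.1 h7)]
        linarith [h5.2]
      refine (Finset.sum_le_sum h4).trans ?_
      rw [Finset.sum_const, Finset.card_univ, Fintype.card_fin, nsmul_eq_mul, ← mul_div_assoc,
        div_le_iff₀ (by positivity)]
      nlinarith
    rw [Finset.sum_sub_distrib] at h1
    rw [abs_le] at h1 h2 h3 ⊢
    constructor <;> linarith
  have hcardδ : (Fintype.card ι + 2) * δ + δ = η := by
    rw [hδ]; field_simp; ring
  have htrunc : ∀ q, ApproxWithin S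
      (N.truncatedOutput σ (e (Sum.inl q)) (N.plane (e (Sum.inl q))).bias) ε := by
    intro q
    refine happ _ _ ?_
    filter_upwards [herr] with x hx
    rw [TwoLayerNetwork.truncatedOutput_bias, hNplane, hNout]
    have h1 : |if (plane (Sum.inl q)).eval x ≤ 0 then
        out (Sum.inl q) * σ ((plane (Sum.inl q)).eval x) else 0| ≤ δ := by
      split_ifs with h
      · simp only [hplane, hout, Sum.elim_inl, OrientedHyperplane.eval_scale] at h ⊢
        -- On the truncated side `ψ q` is zero, so the removed contribution is at most `δ`.
        have h2 := hloc q x hx.1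
        rwa [hψ0 q x (nonpos_of_mul_nonpos_right h (hρ q)), sub_zero] at h2
      · simpa using hδ0.le
    have h2 := hx.2
    rw [abs_le] at h1 h2 ⊢
    constructor <;> linarith
  refine ⟨_, N, ⟨?_, ?_⟩⟩
  · refine happ _ _ ?_
    filter_upwards [herr] with x hx
    linarith [hx.2]
  · set g := (Equiv.ofInjective l hl).symm with hg
    have hlg : ∀ h, l (g h) = h := fun h => Equiv.apply_ofInjective_symm hl h
    have hrange : ∀ q, e (Sum.inl q) ∈ Set.range fun h : Set.range l => e (Sum.inl (g h)) :=
      fun q => ⟨⟨l q, q, rfl⟩, congrArg (fun z => e (Sum.inl z)) (hl (hlg _))⟩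
    refine ⟨fun h => e (Sum.inl (g h)), ?_, ?_, ?_, ?_⟩
    · exact e.injective.comp (Sum.inl_injective.comp g.injective)
    · intro h
      refine TwoLayerNetwork.isZeroErrorHyperplane_of_scale (hρ (g h)) ?_ (htrunc _)
      rw [hNplane, ← hlg h]
      simp [hplane, hlg]
    · intro i hi
      obtain ⟨i, rfl⟩ := e.surjective i
      rw [hNplane]
      rcases i with q | h | j
      · exact absurd (hrange q) hi
      · exact h.1.2
      · exact OrientedHyperplane.isUniversalGlobal_shifted i₀ (Nat.cast_nonneg _)
    · refine hM.trans ?_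
      have h1 : Set.ncard (Set.range fun j : Fin M =>
          (OrientedHyperplane.shifted i₀ (j : ℝ)).carrier) = M := by
        rw [← Set.image_univ, Set.ncard_image_of_injective, Set.ncard_univ, Nat.card_fin]
        intro j j' hjj
        have := OrientedHyperplane.carrier_shifted_injective i₀ hjj
        exact Fin.ext (by exact_mod_cast this)
      refine h1.ge.trans (Set.ncard_le_ncard ?_ (Set.toFinite _))
      rintro _ ⟨j, rfl⟩
      refine ⟨e (Sum.inr (Sum.inr j)), ?_, ?_⟩
      · rintro ⟨h, hh⟩
        simpa using e.injective hh
      · change (N.plane (e (Sum.inr (Sum.inr j)))).carrier = _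
        rw [hNplane]
        rfl

end Realization

end

/-! ### The theorem. -/

theorem theorem17 (n m : ℕ) (hn : 2 ≤ n) (hm : 1 ≤ m)
    (H : Set (OrientedHyperplane n)) (hH : IsStandardPartition H)
    (σ : ℝ → ℝ) (hσ : IsGeneralizedSigmoidal σ) (hσm : ContDiff ℝ m σ)
    (hdeg : ∀ P : Polynomial ℝ, (∀ t : ℝ, 0 < t → σ t = P.eval t) → P.natDegree = m)
    (S : EuclideanSpace ℝ (Fin n) → ℝ) (hS : S ∈ splineSpace H m) :
    (∀ ε : ℝ, 0 < ε → ∃ (Θ : ℕ) (N : TwoLayerNetwork n Θ), N.RealizesFrom σ m H S ε) ∧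
    (regions H).Finite ∧
    ∀ (ε : ℝ) (Θ : ℕ) (N : TwoLayerNetwork n Θ), 0 < ε → N.RealizesFrom σ m H S ε →
      (((regions H).ncard : ℝ) ^ (1 / (n : ℝ)) - 1) * (n : ℝ) + ((n + m).choose m : ℝ) ≤ (Θ : ℝ) := by
  have hn0 : n ≠ 0 := by omega
  have hm0 : m ≠ 0 := by omega
  obtain ⟨k, l, rfl, hl, hcells⟩ := hH
  have hne : FullCells l := by
    intro c hc
    obtain ⟨x, hx, hx'⟩ := hcells fun i => ⟨c i, Nat.lt_succ_of_le (hc i)⟩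
    exact ⟨x, hx, fun i j => hx' i j⟩
  refine ⟨fun ε hε => ?_, finite_regions l hl, fun ε Θ N _ hN => ?_⟩
  · obtain ⟨p, A, hpm, hA⟩ := hne.exists_truncatedPower_repr hm0 hS
    have hrange : {h | ∃ i j, h = l i j} =
        Set.range fun q : (i : Fin n) × Fin (k i) => l q.1 q.2 := by
      ext h
      simp [eq_comm]
    rw [hrange]
    set f : C(ℝ, ℝ) := ⟨σ, hσ.contDiff.continuous⟩ with hf
    have hae : ∀ᵐ x ∂volume.restrict (unitCube n), S x = polyEval p x +
        ∑ q : (i : Fin n) × Fin (k i), A q.1 q.2 * max ((l q.1 q.2).eval x) 0 ^ m := by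
      filter_upwards [ae_exists_mem_cell hl] with x ⟨c, hc, hx⟩
      rw [hA c hc x hx, Fintype.sum_sigma]
    by_cases hpoly : ∃ P : Polynomial ℝ, ∀ t, 0 < t → σ t = P.eval t
    · obtain ⟨P, hP⟩ := hpoly
      have hPm : P.natDegree = m := hdeg P hP
      refine exists_realizesFrom hn0 hne.injective m _ le_rfl f (S := S)
        (T := restrictPolynomial n p)
        (ψ := fun q x => A q.1 q.2 * max ((l q.1 q.2).eval x) 0 ^ m) ?_ ?_ ?_ ?_ hε
      · refine restrictPolynomial_mem hn0 f p ?_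
        -- Such a `Q` would have degree `m` by `hdeg`, yet degree below that of `p`, which is at
        -- most `m`.
        rintro ⟨Q, hQ, hQf⟩
        have h1 := hdeg Q hQf
        have hQ0 : Q ≠ 0 := by
          rintro rfl
          simp at h1
          omega
        rw [Polynomial.degree_eq_natDegree hQ0, h1] at hQ
        have : m < p.totalDegree := by exact_mod_cast hQ
        omega
      · intro q x hx
        rw [max_eq_right hx, zero_pow hm0, mul_zero]
      · intro q δ hδ
        obtain ⟨M, hM⟩ := (l q.1 q.2).exists_abs_eval_le
        obtain ⟨lam, ρ, h1, h2, h3⟩ := hσ.exists_abs_sub_truncatedPower_le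
          (P := P) (by omega) hP (A q.1 q.2) M hδ
        rw [hPm] at h3
        exact ⟨lam, ρ, h1, h2, fun x hx => h3 _ (hM x hx)⟩
      · filter_upwards [hae] with x hx hxU
        rw [hx, restrictPolynomial_apply]
    · have hcont : Continuous fun x => polyEval p x +
          ∑ q : (i : Fin n) × Fin (k i), A q.1 q.2 * max ((l q.1 q.2).eval x) 0 ^ m := by
        have := continuous_polyEval p
        fun_prop
      -- The global units carry the whole continuous function, so the local targets `ψ` are zero.
      refine exists_realizesFrom hn0 hne.injective m _ le_rfl f (S := S)
        (T := ⟨fun x => _, hcont.comp continuous_subtype_val⟩) (ψ := fun _ _ => 0) ?_ ?_ ?_ ?_ hε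
      · rw [globalClosure_eq_top hn0 f hpoly]
        trivial
      · exact fun _ _ _ => rfl
      · intro q δ hδ
        obtain ⟨M, hM⟩ := (l q.1 q.2).exists_abs_eval_le
        obtain ⟨lam, h1, h2⟩ := exists_abs_mul_le_of_continuous f.continuous M hδ
        refine ⟨lam, 1, h1.ne', one_pos, fun x hx => ?_⟩
        rw [one_mul, sub_zero, abs_mul, abs_of_pos h1]
        exact h2 _ (hM x hx)
      · filter_upwards [hae] with x hx hxU
        rw [hx]
        simp
  · have h1 := hN.ncard_add_choose_le
    rw [hne.ncard_eq] at h1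
    have h2 := rpow_prod_sub_one_mul_le hn0 k (ncard_regions_le l hl)
    have h3 : ((∑ i, k i : ℕ) : ℝ) + ((n + m).choose m : ℝ) ≤ (Θ : ℝ) := by exact_mod_cast h1
    linarith
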